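/- All graphs are finite and simple. The stable partition $\mathcal{P}_G$ of a graph $G$ is the partition of $V(G)$ at which color refinement halts: start from the one-cell partition and repeatedly separate two vertices of the same cell when they have different numbers of neighbors in some cell, until nothing changes. $G$ is amenable if for every graph $H$ color refinement decides correctly whether $G\cong H$, i.e. every cell of $\mathcal{P}_{G\cup H}$ (disjoint union) contains equally many vertices of $G$ and of $H$ if and only if $G\cong H$. A cell $X$ is homogeneous if $G[X]$ is empty or complete, and heterogeneous otherwise. A pair of distinct cells $X,Y$ is isotropic if the bipartite graph $G[X,Y]$ is empty or complete bipartite, and anisotropic otherwise. The anisotropic components are the connected components of the graph whose vertices are the cells and whose edges are the anisotropic pairs. Let $G$ be an amenable graph, $A$ an anisotropic component, and $G_A$ the subgraph of $G$ induced by the union of the cells of $A$. Root $A$ (which is a tree) at a cell $R$, namely at a heterogeneous cell of $A$ if there is one, and otherwise at a cell of $A$ of least cardinality. Let $J$ be the graph on $V(G_A)$ obtained from $G_A$ by replacing the following by their (bipartite) complements: $G[R]$, if it is empty or a matching graph $rK_2$ with $r\ge 2$; $G[X]$ for each cell $X\ne R$ of $A$ for which it is complete; $G[X,Y]$ for each isotropic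 pair of cells of $A$ for which it is complete bipartite; and $G[X,Y]$ for each anisotropic pair of cells of $A$ for which it is the bipartite complement of a disjoint union of stars $sK_{1,t}$, $t\ge1$, with all centers in one of the two cells and all leaves in the other. The head of $J$ is $H=J[R]$. A vertex $x$ of $J$ is the parent of $y$ if $xy\in E(J)$ and the cell of $x$ is the parent of the cell of $y$ in $A$. For a vertex $x$, $L_x$ is the subgraph of $J$ induced by $x$ and the vertices that have $x$ as an ancestor; for $v\in R$, $L_v$ is the leg of $J$ at $v$. For a graph $F$, $\mathrm{Fix}(F)$ is the least size of a set $S\subseteq V(F)$ such that the identity is the only automorphism of $F$ that fixes every element of $S$. For $V(F)\subseteq V(G)$, $\mathrm{Fix}(F,\mathcal{P}_G)$ is defined in the same way with only those automorphisms of $F$ that map each vertex to a vertex of the same cell of $\mathcal{P}_G$. **Theorem.** (1) For every $v\in V(H)$: if $\mathrm{Fix}(L_v,\mathcal{P}_G)=0$, then $\mathrm{Fix}(J,\mathcal{P}_G)=\mathrm{Fix}(H)$; otherwise $\mathrm{Fix}(J,\mathcal{P}_G)=|V(H)|\cdot \mathrm{Fix}(L_v,\mathcal{P}_G)$. (2)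 Let $X$ be a cell of $A$, let $Y_1,\dots,Y_\ell$ ($\ell\ge 0$) be its children in $A$, and put $m_j=|Y_j|/|X|$. Then every $m_j$ is an integer, and for every $x\in X$ and all $y_j\in Y_j$, $$\mathrm{Fix}(L_x,\mathcal{P}_G)=\sum_{j=1}^{\ell}\Big[(m_j-1)\,\mathbf 1_{(\mathrm{Fix}(L_{y_j},\mathcal{P}_G)=0)}+m_j\,\mathrm{Fix}(L_{y_j},\mathcal{P}_G)\,\mathbf 1_{(\mathrm{Fix}(L_{y_j},\mathcal{P}_G)\ne 0)}\Big].$$ In particular $\mathrm{Fix}(L_x,\mathcal{P}_G)=0$ when $X$ is a leaf of $A$, and $\mathrm{Fix}(L_v,\mathcal{P}_G)$ is computed recursively from the leaves of $A$ up to the root. -/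

import Mathlib

open scoped SimpleGraph

namespace AmenableGraph

universe u

/- ### Color refinement -/

section ColorRefinement

variable {V : Type u} (G : SimpleGraph V)

/-- One round of color refinement: `u` and `v` stay in the same cell iff they are in the same cell
of `r` and have the same number of neighbors in each cell of `r` (the cell of `z`, for every `z`). -/
def refineStep (r : Setoid V) : Setoid V where
  r u v := r u v ∧ ∀ z, {w | G.Adj u w ∧ r w z}.ncard = {w | G.Adj v w ∧ r w z}.ncard
  iseqv :=
    { refl := fun u => ⟨r.refl u, fun _ => rfl⟩
      symm := fun h => ⟨r.symm h.1, fun z => (h.2 z).symm⟩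
      trans := fun h k => ⟨r.trans h.1 k.1, fun z => (h.2 z).trans (k.2 z)⟩ }

/-- The partition after `i` rounds, starting from the partition with the single cell `V(G)`. -/
def refinementRound (i : ℕ) : Setoid V := (refineStep G)^[i] ⊤

/-- The stable partition `P_G`. Since the rounds get finer and finer, on a finite graph their
common refinement is the partition at which the algorithm halts (see `exists_refinementRound_eq` and
`stablePartition_eq_refinementRound`). -/
def stablePartition : Setoid V := ⨅ i, refinementRound G i

lemma refineStep_le (r : Setoid V) : refineStep G r ≤ r := fun _ _ h => h.1

lemma refinementRound_succ (i : ℕ) : refinementRound G (i + 1) = refineStep G (refinementRound G i) :=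
  Function.iterate_succ_apply' _ _ _

lemma refinementRound_antitone : Antitone (refinementRound G) :=
  antitone_nat_of_succ_le fun i => by rw [refinementRound_succ]; exact refineStep_le G _

/-- On a finite graph the algorithm halts. -/
lemma exists_refinementRound_eq [Finite V] : ∃ i, refinementRound G (i + 1) = refinementRound G i := by
  have : Finite (Setoid V) :=
    Finite.of_injective (fun r : Setoid V => fun p : V × V => r p.1 p.2) fun r s h =>
      Setoid.ext fun a b => iff_of_eq (congrFun h (a, b))
  by_contra hne
  push Not at hne
  have : StrictAnti (refinementRound G) := strictAnti_nat_of_succ_lt fun i =>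
    lt_of_le_of_ne (refinementRound_antitone G (Nat.le_succ i)) (hne i)
  exact not_injective_infinite_finite _ this.injective

/-- The partition at which the algorithm halts is the stable partition. -/
lemma stablePartition_eq_refinementRound {i : ℕ} (h : refinementRound G (i + 1) = refinementRound G i) :
    stablePartition G = refinementRound G i := by
  refine le_antisymm (iInf_le _ i) (le_iInf fun j => ?_)
  rcases le_total j i with hj | hj
  · exact refinementRound_antitone G hj
  · have : ∀ k, refinementRound G (i + k) = refinementRound G i := by
      intro k
      induction k with
      | zero => rfl
      | succ k ih => rw [← add_assoc, refinementRound_succ, ih, ← refinementRound_succ, h]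
    obtain ⟨k, rfl⟩ := Nat.exists_eq_add_of_le hj
    exact (this k).ge

/-- The cells of `P_G`. -/
def Cell : Type u := Quotient (stablePartition G)

/-- The cell of `P_G` that contains `v`. -/
def cellOf (v : V) : Cell G := Quotient.mk (stablePartition G) v

variable {G}

/-- A cell as a set of vertices. -/
def Cell.verts (X : Cell G) : Set V := {v | cellOf G v = X}

/-- The cardinality of a cell. -/
noncomputable def Cell.size (X : Cell G) : ℕ := X.verts.ncard

end ColorRefinement

/- ### Amenable graphs -/

/-- Color refinement, applied to the disjoint union of `G` and `H`, concludes that `G ≅ H`: each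
cell of the stable partition of the union has equally many vertices of `G` and of `H`. -/
def RefinementConcludesIso {V : Type*} {W : Type*} (G : SimpleGraph V) (H : SimpleGraph W) : Prop :=
  ∀ X : Cell (G ⊕g H),
    {v : V | cellOf (G ⊕g H) (Sum.inl v) = X}.ncard =
      {w : W | cellOf (G ⊕g H) (Sum.inr w) = X}.ncard

/-- `G` is amenable: for every finite graph `H`, color refinement correctly determines whether
`G ≅ H`. (Every finite graph is isomorphic to one whose vertex type lives in `Type`.) -/
def IsAmenable {V : Type*} (G : SimpleGraph V) : Prop :=
  ∀ (W : Type) [Finite W] (H : SimpleGraph W), RefinementConcludesIso G H ↔ Nonempty (G ≃g H)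

/- ### Shapes of induced graphs and of induced bipartite graphs -/

section Shapes

variable {V : Type*}

/-- `G[X]` is an empty graph. -/
def IsEmptyOn (G : SimpleGraph V) (X : Set V) : Prop := ∀ x ∈ X, ∀ y ∈ X, ¬ G.Adj x y

/-- `G[X]` is a complete graph. -/
def IsCompleteOn (G : SimpleGraph V) (X : Set V) : Prop := ∀ x ∈ X, ∀ y ∈ X, x ≠ y → G.Adj x y

/-- `G[X]` is a matching graph `r K₂` with `r ≥ 2`. -/
def IsMatchingOn (G : SimpleGraph V) (X : Set V) : Prop :=
  4 ≤ X.ncard ∧ ∀ x ∈ X, ∃! y, y ∈ X ∧ G.Adj x y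

/-- `G[X, Y]` is an empty bipartite graph. -/
def IsEmptyBetween (G : SimpleGraph V) (X Y : Set V) : Prop := ∀ x ∈ X, ∀ y ∈ Y, ¬ G.Adj x y

/-- `G[X, Y]` is a complete bipartite graph. -/
def IsCompleteBetween (G : SimpleGraph V) (X Y : Set V) : Prop := ∀ x ∈ X, ∀ y ∈ Y, G.Adj x y

/-- The bipartite graph with sides `X`, `Y` and edge relation `adj` is a disjoint union of stars
`K_{1,t}`, `t ≥ 1`, whose centers are the elements of `X` and whose leaves are those of `Y`. -/
def IsStarsFrom (adj : V → V → Prop) (X Y : Set V) : Prop :=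
  ∃ t, 1 ≤ t ∧ (∀ x ∈ X, {y | y ∈ Y ∧ adj x y}.ncard = t) ∧ ∀ y ∈ Y, ∃! x, x ∈ X ∧ adj x y

/-- `G[X, Y]` is the bipartite complement of a disjoint union of stars `s K_{1,t}` that has its
centers on one side and its leaves on the other. -/
def IsCoStarsBetween (G : SimpleGraph V) (X Y : Set V) : Prop :=
  IsStarsFrom (fun a b => ¬ G.Adj a b) X Y ∨ IsStarsFrom (fun a b => ¬ G.Adj a b) Y X

end Shapes

/- ### The cell graph and its anisotropic components -/

section CellGraph

variable {V : Type u} (G : SimpleGraph V)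

/-- A cell is homogeneous if it induces an empty or a complete graph. -/
def IsHomogeneous (X : Cell G) : Prop := IsEmptyOn G X.verts ∨ IsCompleteOn G X.verts

/-- A pair of cells is isotropic if it induces an empty or a complete bipartite graph. -/
def IsIsotropic (X Y : Cell G) : Prop :=
  IsEmptyBetween G X.verts Y.verts ∨ IsCompleteBetween G X.verts Y.verts

lemma IsIsotropic.symm {G : SimpleGraph V} {X Y : Cell G} (h : IsIsotropic G X Y) :
    IsIsotropic G Y X :=
  h.imp (fun h y hy x hx hyx => h x hx y hy hyx.symm) fun h y hy x hx => (h x hx y hy).symm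

/-- The cell graph with its isotropic edges deleted. -/
def anisotropicGraph : SimpleGraph (Cell G) where
  Adj X Y := X ≠ Y ∧ ¬ IsIsotropic G X Y
  symm := ⟨fun _ _ h => ⟨h.1.symm, fun k => h.2 k.symm⟩⟩
  loopless := ⟨fun _ h => h.1 rfl⟩

/-- The anisotropic components of the cell graph. -/
abbrev AnisotropicComponent := (anisotropicGraph G).ConnectedComponent

variable {G}

/-- `R` is an admissible root of `A`: a heterogeneous cell of `A` if there is one, and otherwise a
cell of `A` of least cardinality. -/
def IsRoot (A : AnisotropicComponent G) (R : Cell G) : Prop :=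
  R ∈ A.supp ∧
    ((∃ X ∈ A.supp, ¬ IsHomogeneous G X) → ¬ IsHomogeneous G R) ∧
    ((∀ X ∈ A.supp, IsHomogeneous G X) → ∀ X ∈ A.supp, R.size ≤ X.size)

/-- `Y` is a child of `X` in the anisotropic component rooted at `R`. -/
def IsChildCell (R X Y : Cell G) : Prop :=
  (anisotropicGraph G).Adj X Y ∧
    (anisotropicGraph G).dist R Y = (anisotropicGraph G).dist R X + 1

/-- The vertices of `G_i`: the union of the cells of the anisotropic component. -/
def compVerts (A : AnisotropicComponent G) : Set V := {v | cellOf G v ∈ A.supp}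

/- ### The celled jellyfish graph -/

/-- The induced graphs `G[X]` (when `X = Y`) and `G[X, Y]` (when `X ≠ Y`) that are replaced by
their complement when `G_i` is modified, given that `R` is the root:
* `G[R]` if it is a matching graph or an empty graph;
* `G[X]` for a cell `X ≠ R` if it is a complete graph;
* `G[X, Y]` for an isotropic pair if it is complete bipartite;
* `G[X, Y]` for an anisotropic pair if it is the bipartite complement of `s K_{1,t}`. -/
def IsComplemented (R X Y : Cell G) : Prop :=
  (X = Y ∧ X = R ∧ (IsMatchingOn G X.verts ∨ IsEmptyOn G X.verts)) ∨
  (X = Y ∧ X ≠ R ∧ IsCompleteOn G X.verts) ∨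
  (X ≠ Y ∧ IsIsotropic G X Y ∧ IsCompleteBetween G X.verts Y.verts) ∨
  (X ≠ Y ∧ ¬ IsIsotropic G X Y ∧ IsCoStarsBetween G X.verts Y.verts)

lemma IsComplemented.symm {R X Y : Cell G} (h : IsComplemented R X Y) : IsComplemented R Y X := by
  rcases h with ⟨rfl, h⟩ | ⟨rfl, h⟩ | ⟨hne, h, k⟩ | ⟨hne, h, k⟩
  · exact Or.inl ⟨rfl, h⟩
  · exact Or.inr (Or.inl ⟨rfl, h⟩)
  · exact Or.inr (Or.inr (Or.inl ⟨hne.symm, h.symm, fun y hy x hx => (k x hx y hy).symm⟩))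
  · exact Or.inr (Or.inr (Or.inr ⟨hne.symm, fun h' => h h'.symm, k.symm⟩))

/-- The graph `J_i` on `V(G_i)`, obtained from `G_i` by the complementations above. -/
def jellyfish (A : AnisotropicComponent G) (R : Cell G) : SimpleGraph (compVerts A) where
  Adj u v := u ≠ v ∧
    ((G.Adj u v ∧ ¬ IsComplemented R (cellOf G u) (cellOf G v)) ∨
      (¬ G.Adj u v ∧ IsComplemented R (cellOf G u) (cellOf G v)))
  symm := ⟨fun _ _ h => ⟨h.1.symm, h.2.imp
    (fun k => ⟨k.1.symm, fun c => k.2 c.symm⟩)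
    (fun k => ⟨fun c => k.1 c.symm, k.2.symm⟩)⟩⟩
  loopless := ⟨fun _ h => h.1 rfl⟩

/-- The vertices of the head of `J_i`: those in the root cell. -/
def headVerts (A : AnisotropicComponent G) (R : Cell G) : Set (compVerts A) :=
  {v | cellOf G v = R}

/-- The head `H = J_i[R]`. -/
def head (A : AnisotropicComponent G) (R : Cell G) : SimpleGraph (headVerts A R) :=
  (jellyfish A R).induce (headVerts A R)

/-- `x` is the parent of `y` in `J_i`: they are adjacent, and the cell of `x` is the parent of the
cell of `y`. -/
def IsParent (A : AnisotropicComponent G) (R : Cell G) (x y : compVerts A) : Prop :=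
  IsChildCell R (cellOf G x) (cellOf G y) ∧ (jellyfish A R).Adj x y

/-- The vertices of `L_x`: `x` itself and the vertices that have `x` as an ancestor. -/
def legVerts (A : AnisotropicComponent G) (R : Cell G) (x : compVerts A) : Set (compVerts A) :=
  {y | Relation.ReflTransGen (IsParent A R) x y}

/-- The subgraph `L_x` of `J_i`; for `x` in the root cell it is the leg rooted at `x`. -/
def leg (A : AnisotropicComponent G) (R : Cell G) (x : compVerts A) :
    SimpleGraph (legVerts A R x) :=
  (jellyfish A R).induce (legVerts A R x)

end CellGraph

/- ### Fixing numbers -/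

section Fixing

variable {W : Type*} {C : Type*}

/-- `S` is a fixing set of `F`. -/
def IsFixingSet (F : SimpleGraph W) (S : Finset W) : Prop :=
  ∀ π : F ≃g F, (∀ s ∈ S, π s = s) → ∀ w, π w = w

/-- `Fix(F)`, the size of a smallest fixing set. -/
noncomputable def fixingNumber (F : SimpleGraph W) : ℕ :=
  sInf {n | ∃ S : Finset W, IsFixingSet F S ∧ S.card = n}

/-- `S` is a fixing set of the celled graph `F`, whose cells are the fibers of `κ`: only the
identity is a cell-preserving automorphism that fixes every element of `S`. -/
def IsCellFixingSet (F : SimpleGraph W) (κ : W → C) (S : Finset W) : Prop :=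
  ∀ π : F ≃g F, (∀ w, κ (π w) = κ w) → (∀ s ∈ S, π s = s) → ∀ w, π w = w

/-- The size of a smallest fixing set of the celled graph `F` whose cells are the fibers of `κ`. -/
noncomputable def cellFixingNumber (F : SimpleGraph W) (κ : W → C) : ℕ :=
  sInf {n | ∃ S : Finset W, IsCellFixingSet F κ S ∧ S.card = n}

variable {V : Type u} {G : SimpleGraph V}

/-- `Fix(J_i, P_G)`. -/
noncomputable def fixJellyfish (A : AnisotropicComponent G) (R : Cell G) : ℕ :=
  cellFixingNumber (jellyfish A R) fun v => cellOf G v.1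

/-- `Fix(L_x, P_G)`. -/
noncomputable def fixLeg (A : AnisotropicComponent G) (R : Cell G) (x : compVerts A) : ℕ :=
  cellFixingNumber (leg A R x) fun v => cellOf G v.1.1

end Fixing

end AmenableGraph

open AmenableGraph

/-! Amenability is used in one form, `IsAmenable.exists_perm`: a graph on the same vertices with the
same number of neighbors in each cell is isomorphic to `G` by a cell-preserving permutation. So the
graph on one pair of cells may be replaced by any other with the same degrees, or displaced by any
cell-preserving permutation, without changing the isomorphism type.

Replacement gives the shape of anisotropic pairs. If all degrees and codegrees between two cells
were at least 2, there would be two non-isomorphic biregular graphs with these degrees, a blown-up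
circulant graph and a switching of it (`exists_isBiregular_not_areIsomorphic`). Hence such a pair
consists of stars or co-stars (`IsAmenable.isStarsFrom`).

Displacement gives the shape of the component. The graph on a pair `e` and the graph on all other
pairs can be put in arbitrary relative position. So they cannot both determine a nontrivial regular
graph on the same cell, since the number of common edges would depend on the position
(`IsAmenable.not_hasInvariantGraph`); nor can the other pairs determine a bijection between the two
cells of an anisotropic pair (`IsAmenable.not_linked`). Stars between cells of different sizes
determine a nontrivial graph on the larger cell, stars between cells of equal size determine a
bijection, and a heterogeneous cell carries its own graph. A cycle, a decrease of cardinality away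
from the root, or a heterogeneous cell besides the root would therefore give a forbidden coincidence
(`IsAmenable.exists_parentCell`). It follows that `J` is its head with rooted trees attached, in
which vertices of one cell have equally many children in each child cell
(`IsAmenable.exists_isJellyfish`).

The rest is counting in such a graph. Trees below siblings of the same cell can be exchanged by an
automorphism, and an automorphism that fixes a parent but moves a child carries the tree below the
child to a disjoint one. So a set fixes `L_x` exactly when it meets, for any two such siblings, the
tree below one of them (`IsJellyfish.isFixingOn_below_iff`). Among `m` siblings of one cell with
rigid trees all but one must be met; non-rigid trees each need their own number of vertices and are
then met anyway (`IsJellyfish.hitNumber_eq`). For the whole of `J`, non-rigid legs contain fixed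
vertices and thereby pin the head; if the legs are rigid, a vertex of a fixing set may be replaced
by the head vertex above it. -/

namespace AmenableGraph

/-! ### Equitable partitions and the basic consequence of amenability -/

/-- Neighbor counts that agree on every class of `s` agree on every class of a coarser `r`. -/
lemma ncard_eq_of_setoid_le {V : Type*} [Finite V] {s r : Setoid V} (hsr : s ≤ r) {p q : V → Prop}
    (h : ∀ z, {w | p w ∧ s w z}.ncard = {w | q w ∧ s w z}.ncard) (z : V) :
    {w | p w ∧ r w z}.ncard = {w | q w ∧ r w z}.ncard := by
  classical
  have := Fintype.ofFinite V
  have key : ∀ p : V → Prop, {w | p w ∧ r w z}.ncard =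
      ∑ c : Quotient s, if r c.out z then {w | p w ∧ s w c.out}.ncard else 0 := by
    intro p
    rw [Set.ncard_eq_toFinset_card', Finset.card_eq_sum_card_fiberwise (f := Quotient.mk s)
      (t := Finset.univ) (fun _ _ => Finset.mem_coe.2 (Finset.mem_univ _))]
    refine Finset.sum_congr rfl fun c _ => ?_
    split_ifs with hc
    · rw [Set.ncard_eq_toFinset_card']
      congr 1
      ext w
      simp only [Set.toFinset_ofPred, Finset.mem_filter, Finset.mem_univ, true_and]
      constructor
      · rintro ⟨⟨h1, h2⟩, h3⟩
        refine ⟨h1, ?_⟩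
        rw [← h3]
        exact s.symm (Quotient.mk_out (s := s) w)
      · rintro ⟨h1, h2⟩
        refine ⟨⟨h1, r.trans (hsr h2) hc⟩, ?_⟩
        rw [← Quotient.out_eq c]
        exact Quotient.sound h2
    · rw [Finset.card_eq_zero, Finset.filter_eq_empty_iff]
      rintro w hw rfl
      simp only [Set.toFinset_ofPred, Finset.mem_filter, Finset.mem_univ, true_and] at hw
      exact hc (r.trans (hsr (Quotient.mk_out (s := s) w)) hw.2)
  rw [key p, key q]
  simp_rw [h]

/-- The stable partition is coarser than every equitable partition. -/
lemma le_stablePartition {V : Type*} [Finite V] (G : SimpleGraph V) (s : Setoid V)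
    (hs : ∀ u v, s u v → ∀ z, {w | G.Adj u w ∧ s w z}.ncard = {w | G.Adj v w ∧ s w z}.ncard) :
    s ≤ stablePartition G := by
  refine le_iInf fun i => ?_
  induction i with
  | zero => exact le_top
  | succ i ih =>
    rw [refinementRound_succ]
    exact fun u v huv => ⟨ih huv, ncard_eq_of_setoid_le ih (hs u v huv)⟩

/-- The stable partition is equitable. -/
lemma stablePartition_equitable {V : Type*} [Finite V] (G : SimpleGraph V) {u v : V}
    (h : stablePartition G u v) (z : V) :
    {w | G.Adj u w ∧ stablePartition G w z}.ncard =
      {w | G.Adj v w ∧ stablePartition G w z}.ncard := by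
  obtain ⟨i, hi⟩ := exists_refinementRound_eq G
  rw [stablePartition_eq_refinementRound G hi] at h ⊢
  rw [← hi, refinementRound_succ] at h
  exact h.2 z

/-- An amenable graph is isomorphic, cell by cell, to every graph on the same vertices that has
the same number of neighbors in each cell. -/
lemma IsAmenable.exists_perm {V : Type*} [Finite V] {G : SimpleGraph V} (hG : IsAmenable G)
    (H : SimpleGraph V)
    (hH : ∀ u z, {w | H.Adj u w ∧ stablePartition G w z}.ncard =
      {w | G.Adj u w ∧ stablePartition G w z}.ncard) :
    ∃ φ : Equiv.Perm V, (∀ v, cellOf G (φ v) = cellOf G v) ∧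
      ∀ u v, H.Adj (φ u) (φ v) ↔ G.Adj u v := by
  obtain ⟨n, ⟨e⟩⟩ := Finite.exists_equiv_fin V
  set H' : SimpleGraph (Fin n) := H.comap e.symm with hH'
  -- `f` identifies the two copies of the vertex set. The pullback of the stable partition along `f`
  -- is equitable on the union, and each of its classes has equally many vertices on both sides.
  set f : V ⊕ Fin n → V := Sum.elim id e.symm
  have hcount : ∀ a z, {w | (G ⊕g H').Adj a w ∧ (stablePartition G).comap f w z}.ncard =
      {w | G.Adj (f a) w ∧ stablePartition G w (f z)}.ncard := by
    intro a z
    rcases a with a | a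
    · rw [← Set.ncard_image_of_injective _ (Sum.inl_injective (α := V) (β := Fin n))]
      congr 1
      ext w
      rcases w with w | w <;> simp [f, Setoid.comap_rel]
    · change _ = {w | G.Adj (e.symm a) w ∧ _}.ncard
      rw [← hH, ← Set.ncard_image_of_injective _
        (Sum.inr_injective (α := V).comp e.injective)]
      congr 1
      ext w
      rcases w with w | w
      · simp [f, Setoid.comap_rel]
      · simp only [Set.mem_ofPred_eq, SimpleGraph.sum_adj_inr, hH',
          Setoid.comap_rel, f, Sum.elim_inr, Set.mem_image, Function.comp_apply, Sum.inr.injEq]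
        constructor
        · exact fun h => ⟨e.symm w, h, by simp⟩
        · rintro ⟨x, hx, rfl⟩
          simpa using hx
  have hle : (stablePartition G).comap f ≤ stablePartition (G ⊕g H') :=
    le_stablePartition _ _ fun a b hab z => by
      rw [hcount, hcount]
      exact stablePartition_equitable G hab _
  have hcell : ∀ v, cellOf (G ⊕g H') (Sum.inl v) = cellOf (G ⊕g H') (Sum.inr (e v)) := fun v => by
    exact Quotient.sound (hle (by simp [f, Setoid.comap_rel]))
  obtain ⟨ψ⟩ := (hG (Fin n) H').1 fun X => by
    rw [← Set.ncard_image_of_injective _ e.injective]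
    congr 1
    ext w
    simp only [Set.mem_image, Set.mem_ofPred_eq, hcell]
    constructor
    · rintro ⟨x, hx, rfl⟩
      exact hx
    · exact fun h => ⟨e.symm w, by simpa using h, by simp⟩
  set φ : Equiv.Perm V := ψ.toEquiv.trans e.symm with hφ
  have hadj : ∀ u v, H.Adj (φ u) (φ v) ↔ G.Adj u v := fun u v => ψ.map_rel_iff (a := u) (b := v)
  refine ⟨φ, fun v => Quotient.sound ?_, hadj⟩
  -- The isomorphism preserves cells because refinement is canonical: `H` has the same neighbor
  -- counts as `G` into cells, hence into the coarser classes of every round.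
  suffices h : ∀ i v, refinementRound G i (φ v) v by
    rintro _ ⟨i, rfl⟩
    exact h i v
  intro i
  induction i with
  | zero => exact fun _ => trivial
  | succ i ih =>
    intro v
    rw [refinementRound_succ]
    refine ⟨ih v, fun z => ?_⟩
    rw [← ncard_eq_of_setoid_le (iInf_le (refinementRound G) i) (hH (φ v)) z,
      ← Set.ncard_image_of_injective {w | G.Adj v w ∧ _} φ.injective]
    congr 1
    ext w
    simp only [Set.mem_ofPred_eq, Set.mem_image]
    constructor
    · rintro ⟨h1, h2⟩
      refine ⟨φ.symm w, ⟨?_, ?_⟩, by simp⟩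
      · rw [← hadj]; simpa using h1
      · have := ih (φ.symm w)
        rw [Equiv.apply_symm_apply] at this
        exact (refinementRound G i).trans ((refinementRound G i).symm this) h2
    · rintro ⟨x, ⟨h1, h2⟩, rfl⟩
      exact ⟨(hadj _ _).2 h1, (refinementRound G i).trans (ih x) h2⟩

/-! ### Relative positions of two structures on one finite set -/

lemma injective_vecFour {Y : Type*} {a b c d : Y} (h1 : a ≠ b) (h2 : c ≠ d) (h3 : a ≠ c) (h4 : a ≠ d)
    (h5 : b ≠ c) (h6 : b ≠ d) : Function.Injective ![a, b, c, d] := by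
  intro i j hij
  fin_cases i <;> fin_cases j <;> first
    | rfl
    | exact absurd hij h1
    | exact absurd hij h2
    | exact absurd hij h3
    | exact absurd hij h4
    | exact absurd hij h5
    | exact absurd hij h6
    | exact absurd hij.symm h1
    | exact absurd hij.symm h2
    | exact absurd hij.symm h3
    | exact absurd hij.symm h4
    | exact absurd hij.symm h5
    | exact absurd hij.symm h6

section Overlap

variable {Y : Type*} [Fintype Y] [DecidableEq Y]

/-- If the second differences vanish, `a u d - a v d` does not depend on `d ∉ {u, v}`. Its sum over
these `d` is zero, because row sums agree and the terms at `u` and `v` cancel by symmetry and the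
zero diagonal. So the difference itself is zero. -/
lemma eq_of_secondDifference_eq_zero (a : Y → Y → ℤ) (hsymm : ∀ x y, a x y = a y x)
    (hreg : ∀ x y, ∑ z, a x z = ∑ z, a y z) (hdiag : ∀ x, a x x = 0)
    (h : ∀ x x' y y', x ≠ x' → y ≠ y' → x ≠ y → x ≠ y' → x' ≠ y → x' ≠ y' →
      a x y - a x y' - a x' y + a x' y' = 0)
    {x y x' y' : Y} (hxy : x ≠ y) (hxy' : x' ≠ y') : a x y = a x' y' := by
  have key : ∀ u v c, c ≠ u → c ≠ v → a u c = a v c := by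
    intro u v c hu hv
    by_cases huv : u = v
    · rw [huv]
    have hc : ∀ d ∈ (Finset.univ.erase u).erase v, a u d - a v d = a u c - a v c := by
      intro d hd
      simp only [Finset.mem_erase, Finset.mem_univ, and_true] at hd
      by_cases hdc : d = c
      · rw [hdc]
      have := h u v d c huv hdc hd.2.symm hu.symm hd.1.symm hv.symm
      linarith
    have hsum : ∑ d ∈ (Finset.univ.erase u).erase v, (a u d - a v d) = 0 := by
      have h1 : ∑ d, (a u d - a v d) = 0 := by
        rw [Finset.sum_sub_distrib, hreg u v, sub_self]
      rw [← Finset.add_sum_erase _ _ (Finset.mem_univ u), ← Finset.add_sum_erase _ _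
        (Finset.mem_erase.2 ⟨fun e => huv e.symm, Finset.mem_univ v⟩), hdiag, hdiag,
        hsymm v u] at h1
      linarith
    rw [Finset.sum_congr rfl hc, Finset.sum_const, nsmul_eq_mul, mul_eq_zero] at hsum
    rcases hsum with h0 | h0
    · rw [Nat.cast_eq_zero, Finset.card_eq_zero] at h0
      have : c ∈ (Finset.univ.erase u).erase v := by simp [hu, hv]
      rw [h0] at this
      simp at this
    · linarith
  by_cases hx'y : x' = y
  · subst hx'y
    rw [key x y' x' hxy.symm hxy', hsymm]
  · rw [key x x' y hxy.symm (Ne.symm hx'y), hsymm, key y y' x' hx'y hxy', hsymm]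

/-- The overlap of `a` with a displaced `b` is bilinear. Differencing the displaced `b` along the
disjoint transpositions `(p q)` and `(r s)` leaves a multiple of `u ⊗ v + v ⊗ u`, where `u` and `v`
are the differences of indicators of `p, q` and of `r, s`; hence the product formula. -/
lemma secondDifference_overlap (a b : Y → Y → ℤ) (hsa : ∀ x y, a x y = a y x)
    (hsb : ∀ x y, b x y = b y x) (hdb : ∀ x, b x x = 0)
    (σ : Equiv.Perm Y) {p q r s : Y} (hpq : p ≠ q) (hrs : r ≠ s) (hpr : p ≠ r) (hps : p ≠ s)
    (hqr : q ≠ r) (hqs : q ≠ s) :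
    (∑ x, ∑ y, a x y * b (σ x) (σ y))
      - (∑ x, ∑ y, a x y * b (σ (Equiv.swap p q x)) (σ (Equiv.swap p q y)))
      - (∑ x, ∑ y, a x y * b (σ (Equiv.swap r s x)) (σ (Equiv.swap r s y)))
      + (∑ x, ∑ y, a x y * b (σ (Equiv.swap p q (Equiv.swap r s x)))
          (σ (Equiv.swap p q (Equiv.swap r s y))))
      = 2 * (a p r - a p s - a q r + a q s) *
        (b (σ p) (σ r) - b (σ p) (σ s) - b (σ q) (σ r) + b (σ q) (σ s)) := by
  set D := b (σ p) (σ r) - b (σ p) (σ s) - b (σ q) (σ r) + b (σ q) (σ s) with hD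
  set u : Y → ℤ := fun x => (if x = p then 1 else 0) - (if x = q then 1 else 0) with hu
  set v : Y → ℤ := fun x => (if x = r then 1 else 0) - (if x = s then 1 else 0) with hv
  have key : ∀ x y, b (σ x) (σ y) - b (σ (Equiv.swap p q x)) (σ (Equiv.swap p q y))
      - b (σ (Equiv.swap r s x)) (σ (Equiv.swap r s y))
      + b (σ (Equiv.swap p q (Equiv.swap r s x))) (σ (Equiv.swap p q (Equiv.swap r s y)))
      = D * (u x * v y + v x * u y) := by
    have hcase : ∀ x : Y, x = p ∨ x = q ∨ x = r ∨ x = s ∨ (x ≠ p ∧ x ≠ q ∧ x ≠ r ∧ x ≠ s) := by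
      intro x; tauto
    have hpq' := hpq.symm
    have hrs' := hrs.symm
    have hpr' := hpr.symm
    have hps' := hps.symm
    have hqr' := hqr.symm
    have hqs' := hqs.symm
    intro x y
    have h1 := hsb (σ p) (σ q)
    have h2 := hsb (σ p) (σ r)
    have h3 := hsb (σ p) (σ s)
    have h4 := hsb (σ q) (σ r)
    have h5 := hsb (σ q) (σ s)
    have h6 := hsb (σ r) (σ s)
    clear hsa hsb
    rcases hcase x with hx | hx | hx | hx | ⟨hx1, hx2, hx3, hx4⟩ <;>
    rcases hcase y with hy | hy | hy | hy | ⟨hy1, hy2, hy3, hy4⟩ <;>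
    simp only [*, Equiv.swap_apply_def, if_true, if_false] <;>
    ring
  have hsum : ∑ x, ∑ y, a x y * (D * (u x * v y + v x * u y)) =
      2 * (a p r - a p s - a q r + a q s) * D := by
    simp only [hu, hv, mul_add, add_mul, sub_mul, mul_sub, Finset.sum_add_distrib,
      Finset.sum_sub_distrib]
    simp
    rw [hsa r p, hsa s p, hsa r q, hsa s q]
    ring
  rw [← hsum]
  simp_rw [← key]
  simp only [← Finset.sum_sub_distrib, ← Finset.sum_add_distrib]
  refine Finset.sum_congr rfl fun x _ => Finset.sum_congr rfl fun y _ => ?_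
  ring

/-- Two regular graphs that are neither empty nor complete have relative positions with different
numbers of common edges. -/
lemma exists_perm_overlap_ne (A B : SimpleGraph Y)
    (hA : ∀ x y, {z | A.Adj x z}.ncard = {z | A.Adj y z}.ncard)
    (hB : ∀ x y, {z | B.Adj x z}.ncard = {z | B.Adj y z}.ncard)
    (hA0 : ∃ x y, A.Adj x y) (hA1 : ∃ x y, x ≠ y ∧ ¬ A.Adj x y)
    (hB0 : ∃ x y, B.Adj x y) (hB1 : ∃ x y, x ≠ y ∧ ¬ B.Adj x y) :
    ∃ σ : Equiv.Perm Y, {p : Y × Y | A.Adj p.1 p.2 ∧ B.Adj (σ p.1) (σ p.2)}.ncard ≠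
      {p : Y × Y | A.Adj p.1 p.2 ∧ B.Adj p.1 p.2}.ncard := by
  classical
  set w : SimpleGraph Y → Y → Y → ℤ := fun A x y => if A.Adj x y then 1 else 0 with hw
  have hwd : ∀ (A : SimpleGraph Y),
      (∀ x y, {z | A.Adj x z}.ncard = {z | A.Adj y z}.ncard) →
      (∃ x y, A.Adj x y) → (∃ x y, x ≠ y ∧ ¬ A.Adj x y) →
      ∃ x x' y y', x ≠ x' ∧ y ≠ y' ∧ x ≠ y ∧ x ≠ y' ∧ x' ≠ y ∧ x' ≠ y' ∧
        w A x y - w A x y' - w A x' y + w A x' y' ≠ 0 := by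
    rintro A hA ⟨x, y, hxy⟩ ⟨x', y', hne, hxy'⟩
    by_contra! hcon
    have := eq_of_secondDifference_eq_zero (w A) (fun x y => by simp [hw, A.adj_comm])
      (fun x y => by
        have := hA x y
        simp only [Set.ncard_eq_toFinset_card', Set.toFinset_ofPred] at this
        simp [hw, this]) (fun x => by simp [hw]) hcon hxy.ne hne
    simp [hw, hxy, hxy'] at this
  obtain ⟨p, q, r, s, hpq, hrs, hpr, hps, hqr, hqs, hD⟩ := hwd A hA hA0 hA1
  obtain ⟨p', q', r', s', hpq', hrs', hpr', hps', hqr', hqs', hD'⟩ := hwd B hB hB0 hB1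
  by_contra! hcon
  have hf : ∀ σ : Equiv.Perm Y, ∑ x, ∑ y, w A x y * w B (σ x) (σ y) =
      ({p : Y × Y | A.Adj p.1 p.2 ∧ B.Adj p.1 p.2}.ncard : ℤ) := by
    intro σ
    rw [← hcon σ, ← Finset.sum_product', Set.ncard_eq_toFinset_card', Set.toFinset_ofPred,
      Finset.card_filter, Nat.cast_sum]
    refine Finset.sum_congr rfl fun x _ => ?_
    simp only [hw]
    split_ifs <;> simp_all
  -- The symmetric group moves a quadruple where `A` has a nonzero second difference to one where
  -- `B` has. A constant overlap would make the product of the two differences vanish.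
  obtain ⟨σ, hσ⟩ : ∃ σ : Equiv.Perm Y, σ p = p' ∧ σ q = q' ∧ σ r = r' ∧ σ s = s' := by
    obtain ⟨g, hg⟩ := (Equiv.Perm.isMultiplyPretransitive Y 4).exists_smul_eq
      ⟨_, injective_vecFour hpq hrs hpr hps hqr hqs⟩
        ⟨_, injective_vecFour hpq' hrs' hpr' hps' hqr' hqs'⟩
    have hg' : ∀ i, g (![p, q, r, s] i) = ![p', q', r', s'] i := fun i => DFunLike.congr_fun hg i
    exact ⟨g, hg' 0, hg' 1, hg' 2, hg' 3⟩
  have key := secondDifference_overlap (w A) (w B) (fun x y => by simp [hw, A.adj_comm])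
    (fun x y => by simp [hw, B.adj_comm]) (fun x => by simp [hw]) σ hpq hrs hpr hps hqr hqs
  have e1 := hf σ
  have e2 := hf (σ * Equiv.swap p q)
  have e3 := hf (σ * Equiv.swap r s)
  have e4 := hf (σ * (Equiv.swap p q * Equiv.swap r s))
  simp only [Equiv.Perm.mul_apply] at e2 e3 e4
  rw [e1, e2, e3, e4, hσ.1, hσ.2.1, hσ.2.2.1, hσ.2.2.2] at key
  have : 2 * (w A p r - w A p s - w A q r + w A q s) *
    (w B p' r' - w B p' s' - w B q' r' + w B q' s') ≠ 0 :=
    mul_ne_zero (mul_ne_zero two_ne_zero hD) hD'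
  exact this (by rw [← key]; ring)

/-- The number of points that a permutation and a biregular relation have in common varies with the
permutation. -/
lemma exists_perm_fixed_ne (M : Y → Y → Prop)
    (hrow : ∀ x y, {z | M x z}.ncard = {z | M y z}.ncard)
    (hcol : ∀ x y, {z | M z x}.ncard = {z | M z y}.ncard)
    (h0 : ∃ x y, M x y) (h1 : ∃ x y, ¬ M x y) :
    ∃ σ : Equiv.Perm Y, {x | M x (σ x)}.ncard ≠ {x | M x x}.ncard := by
  classical
  by_contra! hcon
  set w : Y → Y → ℤ := fun x y => if M x y then 1 else 0 with hw
  have hf : ∀ σ : Equiv.Perm Y, ∑ x, w x (σ x) = ({x | M x x}.ncard : ℤ) := by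
    intro σ
    rw [← hcon σ, Set.ncard_eq_toFinset_card', Set.toFinset_ofPred, Finset.card_filter,
      Nat.cast_sum]
    exact Finset.sum_congr rfl fun x _ => by simp [hw]
  -- Some row is neither full nor empty, as all rows have the same size.
  obtain ⟨a, c, d, hac, had⟩ : ∃ a c d, M a c ∧ ¬ M a d := by
    obtain ⟨x, y, hxy⟩ := h0
    obtain ⟨x', y', hxy'⟩ := h1
    by_contra! hfull
    have : {z | M x z} = Set.univ := Set.eq_univ_of_forall fun z => hfull x y z hxy
    have hx' := hrow x x'
    rw [this, Set.ncard_univ, ← Set.ncard_univ] at hx'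
    have := Set.eq_of_subset_of_ncard_le (Set.subset_univ {z | M x' z}) hx'.le
    exact hxy' (this.symm.subset (Set.mem_univ y'))
  have hcd : c ≠ d := fun h => had (h ▸ hac)
  -- Comparing `σ` with `σ * swap a b`, where `σ` sends `a, b` to `c, d`, gives `w a c + w b d = w a
  -- d + w b c`. So every row contains `c` and misses `d`, against the equality of column sizes.
  have hrest : ∀ b, b ≠ a → M b c ∧ ¬ M b d := by
    intro b hb
    obtain ⟨σ, hσa, hσb⟩ : ∃ σ : Equiv.Perm Y, σ a = c ∧ σ b = d := by
      refine ⟨Equiv.swap a c * Equiv.swap b (Equiv.swap a c d), ?_, ?_⟩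
      · rw [Equiv.Perm.mul_apply, Equiv.swap_apply_of_ne_of_ne hb.symm, Equiv.swap_apply_left]
        intro h
        have := congrArg (Equiv.swap a c) h
        rw [Equiv.swap_apply_left, Equiv.swap_apply_self] at this
        exact hcd this
      · rw [Equiv.Perm.mul_apply, Equiv.swap_apply_left, Equiv.swap_apply_self]
    have e1 := hf σ
    have e2 := hf (σ * Equiv.swap a b)
    rw [← e2] at e1
    have hba : b ∈ Finset.univ.erase a := by simp [hb]
    rw [← Finset.add_sum_erase _ _ (Finset.mem_univ a), ← Finset.add_sum_erase _ _ hba,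
      ← Finset.add_sum_erase Finset.univ (fun x => w x ((σ * Equiv.swap a b) x))
        (Finset.mem_univ a),
      ← Finset.add_sum_erase _ (fun x => w x ((σ * Equiv.swap a b) x)) hba] at e1
    rw [Finset.sum_congr rfl (g := fun x => w x (σ x)) (s₁ := (Finset.univ.erase a).erase b)
      (f := fun x => w x ((σ * Equiv.swap a b) x)) fun x hx => by
        simp only [Finset.mem_erase, Finset.mem_univ, and_true] at hx
        rw [Equiv.Perm.mul_apply, Equiv.swap_apply_of_ne_of_ne hx.2 hx.1]] at e1
    simp only [Equiv.Perm.mul_apply, Equiv.swap_apply_left, Equiv.swap_apply_right, hσa, hσb] at e1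
    simp only [hw, hac, had, if_true, if_false] at e1
    by_cases k1 : M b c <;> by_cases k2 : M b d <;> simp_all
    omega
  have := hcol c d
  have hd : {z | M z d} = ∅ := by
    ext z
    simp only [Set.mem_ofPred_eq, Set.mem_empty_iff_false, iff_false]
    by_cases hz : z = a
    · rwa [hz]
    · exact (hrest z hz).2
  rw [hd, Set.ncard_empty, Set.ncard_eq_zero] at this
  exact (this.subset hac : a ∈ (∅ : Set Y))

end Overlap

/-! ### Non-isomorphic biregular bipartite graphs with the same degrees -/

section Biregular

variable {X Y : Type*}

/-- The bipartite graph with sides `X`, `Y` and edge relation `M` has all degrees in `X` equal to `a`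
and all degrees in `Y` equal to `b`. -/
def IsBiregular (M : X → Y → Prop) (a b : ℕ) : Prop :=
  (∀ x, {y | M x y}.ncard = a) ∧ ∀ y, {x | M x y}.ncard = b

/-- A side-preserving isomorphism between two bipartite graphs. -/
def AreIsomorphic (M N : X → Y → Prop) : Prop :=
  ∃ (f : Equiv.Perm X) (g : Equiv.Perm Y), ∀ x y, N (f x) (g y) ↔ M x y

/-- The relation obtained from `M` by exchanging the columns `y₁`, `y₂` in the rows `x₁`, `x₂`. -/
def switch [DecidableEq Y] (M : X → Y → Prop) (x₁ x₂ : X) (y₁ y₂ : Y) (x : X) (y : Y) : Prop :=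
  ((x = x₁ ∨ x = x₂) ∧ M x (Equiv.swap y₁ y₂ y)) ∨ (x ≠ x₁ ∧ x ≠ x₂ ∧ M x y)

lemma switch_of_mem [DecidableEq Y] (M : X → Y → Prop) {x₁ x₂ : X} (y₁ y₂ : Y) {x : X}
    (h : x = x₁ ∨ x = x₂) (y : Y) : switch M x₁ x₂ y₁ y₂ x y ↔ M x (Equiv.swap y₁ y₂ y) := by
  unfold switch; tauto

lemma switch_of_ne [DecidableEq Y] (M : X → Y → Prop) {x₁ x₂ : X} (y₁ y₂ : Y) {x : X}
    (h₁ : x ≠ x₁) (h₂ : x ≠ x₂) (y : Y) : switch M x₁ x₂ y₁ y₂ x y ↔ M x y := by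
  unfold switch; tauto

/-- On the rows `x₁, x₂` and columns `y₁, y₂` the relation is an identity matrix, so exchanging the
two columns there is the same as exchanging the two rows. Thus row sizes and column sizes both
survive. -/
lemma IsBiregular.switch [DecidableEq X] [DecidableEq Y] {M : X → Y → Prop} {a b : ℕ}
    (h : IsBiregular M a b) {x₁ x₂ : X} {y₁ y₂ : Y} (h₁₁ : M x₁ y₁) (h₂₂ : M x₂ y₂)
    (h₁₂ : ¬ M x₁ y₂) (h₂₁ : ¬ M x₂ y₁) : IsBiregular (switch M x₁ x₂ y₁ y₂) a b := by
  constructor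
  · intro x
    rw [← h.1 x]
    by_cases hx : x = x₁ ∨ x = x₂
    · simp_rw [switch_of_mem M y₁ y₂ hx]
      rw [← Set.ncard_image_of_injective {y | M x y} (Equiv.swap y₁ y₂).injective]
      congr 1
      ext y
      simp only [Set.mem_ofPred_eq, Set.mem_image]
      exact ⟨fun h => ⟨_, h, by simp⟩, by rintro ⟨z, hz, rfl⟩; simpa using hz⟩
    · push Not at hx
      simp_rw [switch_of_ne M y₁ y₂ hx.1 hx.2]
  · intro y
    rw [← h.2 y]
    have key : ∀ x, AmenableGraph.switch M x₁ x₂ y₁ y₂ x y ↔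
        if y = y₁ ∨ y = y₂ then M (Equiv.swap x₁ x₂ x) y else M x y := by
      intro x
      by_cases hx : x = x₁ ∨ x = x₂
      · rw [switch_of_mem M y₁ y₂ hx]
        split_ifs with hy
        · rcases hx with rfl | rfl <;> rcases hy with rfl | rfl <;> simp [*]
        · push Not at hy
          rw [Equiv.swap_apply_of_ne_of_ne hy.1 hy.2]
      · push Not at hx
        rw [switch_of_ne M y₁ y₂ hx.1 hx.2, Equiv.swap_apply_of_ne_of_ne hx.1 hx.2, ite_self]
    simp_rw [key]
    split_ifs
    · rw [← Set.ncard_image_of_injective {x | M x y} (Equiv.swap x₁ x₂).injective]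
      congr 1
      ext x
      simp only [Set.mem_ofPred_eq, Set.mem_image]
      exact ⟨fun h => ⟨_, h, by simp⟩, by rintro ⟨z, hz, rfl⟩; simpa using hz⟩
    · rfl

/-- The number of vertices with the same neighborhood as `x`. -/
noncomputable def twinCount (M : X → Y → Prop) (x : X) : ℕ := {x' | ∀ y, M x' y ↔ M x y}.ncard

lemma twinCount_of_iso {M N : X → Y → Prop} (f : Equiv.Perm X) (g : Equiv.Perm Y)
    (h : ∀ x y, N (f x) (g y) ↔ M x y) (x : X) : twinCount N (f x) = twinCount M x := by
  unfold twinCount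
  rw [← Set.ncard_image_of_injective {x' | ∀ y, M x' y ↔ M x y} f.injective]
  congr 1
  ext z
  simp only [Set.mem_ofPred_eq, Set.mem_image]
  constructor
  · refine fun hz => ⟨f.symm z, fun y => ?_, by simp⟩
    rw [← h, ← h, f.apply_symm_apply]
    exact hz _
  · rintro ⟨x', hx', rfl⟩ y
    have := hx' (g.symm y)
    rwa [← h, ← h, g.apply_symm_apply] at this

lemma not_areIsomorphic_of_twinCount {M N : X → Y → Prop} {r : ℕ}
    (hM : ∀ x, twinCount M x = r) {x : X} (hN : twinCount N x ≠ r) : ¬ AreIsomorphic M N := by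
  rintro ⟨f, g, h⟩
  apply hN
  rw [← hM (f.symm x), ← twinCount_of_iso f g h, f.apply_symm_apply]

/-- The circulant bipartite graph in which each residue modulo `q` is adjacent to the `p` residues
from it on, blown up `r` times on one side and `s` times on the other. -/
def arcs (q p r s : ℕ) (x : ZMod q × Fin r) (y : ZMod q × Fin s) : Prop := (y.1 - x.1).val < p

variable {q p r s : ℕ}

lemma ncard_val_lt (hq : 0 < q) (hp : p ≤ q) : {z : ZMod q | z.val < p}.ncard = p := by
  have : NeZero q := ⟨hq.ne'⟩
  rw [← Set.ncard_image_of_injective _ (ZMod.val_injective q)]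
  have : ZMod.val '' {z : ZMod q | z.val < p} = (Finset.range p : Set ℕ) := by
    ext k
    simp only [Set.mem_image, Set.mem_ofPred_eq, Finset.coe_range, Set.mem_Iio]
    constructor
    · rintro ⟨z, hz, rfl⟩
      exact hz
    · exact fun hk => ⟨k, by rwa [ZMod.val_natCast_of_lt (hk.trans_le hp)],
        ZMod.val_natCast_of_lt (hk.trans_le hp)⟩
  rw [this, Set.ncard_coe_finset, Finset.card_range]

lemma arcs_isBiregular (hq : 0 < q) (hp : p ≤ q) :
    IsBiregular (arcs q p r s) (p * s) (p * r) := by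
  constructor
  · intro x
    have : {y | arcs q p r s x y} = ((Equiv.addRight x.1) '' {z | z.val < p}) ×ˢ Set.univ := by
      ext y
      simp only [Set.mem_ofPred_eq, Set.mem_prod, Set.mem_image, Set.mem_univ, and_true, arcs]
      exact ⟨fun h => ⟨_, h, by simp⟩, by rintro ⟨z, hz, h⟩; rw [← h]; simpa using hz⟩
    rw [this, Set.ncard_prod, Set.ncard_image_of_injective _ (Equiv.injective _),
      ncard_val_lt hq hp, Set.ncard_univ, Nat.card_fin]
  · intro y
    have : {x | arcs q p r s x y} = ((Equiv.subLeft y.1) '' {z | z.val < p}) ×ˢ Set.univ := by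
      ext x
      simp only [Set.mem_ofPred_eq, Set.mem_prod, Set.mem_image, Set.mem_univ, and_true, arcs]
      exact ⟨fun h => ⟨_, h, by simp⟩, by rintro ⟨z, hz, h⟩; rw [← h]; simpa using hz⟩
    rw [this, Set.ncard_prod, Set.ncard_image_of_injective _ (Equiv.injective _),
      ncard_val_lt hq hp, Set.ncard_univ, Nat.card_fin]

lemma val_sub_one_of_ne_zero {z : ZMod q} (hq : 1 < q) (h : z ≠ 0) : (z - 1).val = z.val - 1 := by
  have : NeZero q := ⟨by omega⟩
  have : Fact (1 < q) := ⟨hq⟩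
  have h0 : z.val ≠ 0 := by rwa [Ne, ZMod.val_eq_zero]
  rw [ZMod.val_sub (by rw [ZMod.val_one]; omega), ZMod.val_one]

lemma val_neg_one' (hq : 1 < q) : (0 - 1 : ZMod q).val = q - 1 := by
  obtain ⟨k, rfl⟩ : ∃ k, q = k + 1 := ⟨q - 1, by omega⟩
  rw [zero_sub, ZMod.val_neg_one, Nat.add_sub_cancel]

/-- Different arcs of the same length. -/
lemma eq_of_arcs_eq (hp0 : 0 < p) (hpq : p < q) {i i' : ZMod q}
    (h : ∀ j : ZMod q, (j - i').val < p ↔ (j - i).val < p) : i' = i := by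
  have : NeZero q := ⟨by omega⟩
  have hq : 1 < q := by omega
  by_contra hne
  have h1 : (i' - i).val < p := (h i').1 (by simpa using hp0)
  -- The start `i'` of the second arc lies in the first arc. If it is not the start of the first,
  -- its predecessor lies there too, but the predecessor is not in the arc from `i'`, its offset
  -- being `q - 1 ≥ p`.
  have h2 := (h (i' - 1)).2 (by
    have h0 : (i' - i).val ≠ 0 := by rwa [Ne, ZMod.val_eq_zero, sub_eq_zero]
    rw [show i' - 1 - i = i' - i - 1 by ring, val_sub_one_of_ne_zero hq (by rwa [Ne, sub_eq_zero])]
    omega)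
  rw [show i' - 1 - i' = 0 - 1 by ring, val_neg_one' hq] at h2
  omega

/-- Proper nonempty arcs of the same length determine their starting points, so the twins of a
vertex are its `r` copies. -/
lemma twinCount_arcs (hs : 0 < s) (hp0 : 0 < p) (hpq : p < q) (x : ZMod q × Fin r) :
    twinCount (arcs q p r s) x = r := by
  have : {x' | ∀ y, arcs q p r s x' y ↔ arcs q p r s x y} = {x.1} ×ˢ Set.univ := by
    ext x'
    simp only [Set.mem_ofPred_eq, Set.mem_prod, Set.mem_univ, and_true, Set.mem_singleton_iff]
    exact ⟨fun h => eq_of_arcs_eq hp0 hpq fun j => h (j, ⟨0, hs⟩),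
      fun h y => by simp only [arcs, h]⟩
  rw [twinCount, this, Set.ncard_prod, Set.ncard_univ, Nat.card_fin, Set.ncard_singleton, one_mul]

/-- The switching leaves `x₁` without twins other than itself: every row outside `x₁, x₂` still
treats `y₁` and its copy `y₃` alike, whereas `x₁` has lost `y₁` and kept `y₃`, and `x₂` has gained
`y₁`. -/
lemma exists_switch_arcs_of_two_le (hr : 2 ≤ r) (hs : 2 ≤ s) (hp0 : 0 < p) (hpq : p < q) :
    ∃ N : ZMod q × Fin r → ZMod q × Fin s → Prop,
      IsBiregular N (p * s) (p * r) ∧ ¬ AreIsomorphic (arcs q p r s) N := by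
  classical
  have hq : 1 < q := by omega
  have : NeZero q := ⟨by omega⟩
  have : Fact (1 < q) := ⟨hq⟩
  have : NeZero r := ⟨by omega⟩
  have : NeZero s := ⟨by omega⟩
  have hpv : (p : ZMod q).val = p := ZMod.val_natCast_of_lt hpq
  have hp0' : (p : ZMod q) ≠ 0 := fun h => by rw [h, ZMod.val_zero] at hpv; omega
  set x₁ : ZMod q × Fin r := (0, 0)
  set x₂ : ZMod q × Fin r := (1, 0)
  set y₁ : ZMod q × Fin s := (0, 0)
  set y₂ : ZMod q × Fin s := (p, 0)
  set M := arcs q p r s with hM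
  have h₁₁ : M x₁ y₁ := by simpa [hM, arcs, x₁, y₁] using hp0
  have h₁₂ : ¬ M x₁ y₂ := by simp [hM, arcs, x₁, y₂, hpv]
  have h₂₁ : ¬ M x₂ y₁ := by
    simp only [hM, arcs, x₂, y₁]
    rw [val_neg_one' hq]
    omega
  have h₂₂ : M x₂ y₂ := by
    simp only [hM, arcs, x₂, y₂]
    rw [val_sub_one_of_ne_zero hq hp0', hpv]
    omega
  refine ⟨switch M x₁ x₂ y₁ y₂, (arcs_isBiregular (by omega) hpq.le).switch h₁₁ h₂₂ h₁₂ h₂₁,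
    not_areIsomorphic_of_twinCount (r := r) (fun x => twinCount_arcs (by omega) hp0 hpq x)
      (x := x₁) ?_⟩
  have hy₁₂ : y₁ ≠ y₂ := fun h => hp0' (congrArg Prod.fst h).symm
  set y₃ : ZMod q × Fin s := (0, ⟨1, hs⟩) with hy₃
  have hy₃₁ : y₃ ≠ y₁ := by simp [y₃, y₁, Fin.ext_iff]
  have hy₃₂ : y₃ ≠ y₂ := fun h => hp0' (congrArg Prod.fst h).symm
  have : {x' | ∀ y, switch M x₁ x₂ y₁ y₂ x' y ↔ switch M x₁ x₂ y₁ y₂ x₁ y} = {x₁} := by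
    ext x'
    simp only [Set.mem_ofPred_eq, Set.mem_singleton_iff]
    constructor
    · intro h
      by_contra hne
      have e1 := h y₁
      have e3 := h y₃
      rw [switch_of_mem M y₁ y₂ (Or.inl rfl), Equiv.swap_apply_left] at e1
      rw [switch_of_mem M y₁ y₂ (Or.inl rfl), Equiv.swap_apply_of_ne_of_ne hy₃₁ hy₃₂] at e3
      by_cases hx₂ : x' = x₂
      · rw [hx₂, switch_of_mem M y₁ y₂ (Or.inr rfl), Equiv.swap_apply_left] at e1
        exact h₁₂ (e1.1 h₂₂)
      · rw [switch_of_ne M y₁ y₂ hne hx₂] at e1 e3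
        exact h₁₂ (e1.1 (e3.2 h₁₁))
    · rintro rfl y
      rfl
  rw [twinCount, this, Set.ncard_singleton]
  omega

/-- The switching moves the arc `{1, …, p}` of `x₂` to `{0, …, p - 1}`, so `x₂` joins the `r` copies
of the residue `0` and has at least `r + 1` twins. The partner `x₁ = -1` is adjacent to `0` because
`p ≥ 2`, and not to `p` because `p + 2 ≤ q`. -/
lemma exists_switch_arcs_of_eq_one (hr : 1 ≤ r) (hp : 2 ≤ p) (hpq : p + 2 ≤ q) :
    ∃ N : ZMod q × Fin r → ZMod q × Fin 1 → Prop,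
      IsBiregular N (p * 1) (p * r) ∧ ¬ AreIsomorphic (arcs q p r 1) N := by
  classical
  have hq : 1 < q := by omega
  have : NeZero q := ⟨by omega⟩
  have : Fact (1 < q) := ⟨hq⟩
  have : NeZero r := ⟨by omega⟩
  have hpv : (p : ZMod q).val = p := ZMod.val_natCast_of_lt (by omega)
  have hp0' : (p : ZMod q) ≠ 0 := fun h => by rw [h, ZMod.val_zero] at hpv; omega
  set x₁ : ZMod q × Fin r := (-1, 0)
  set x₂ : ZMod q × Fin r := (1, 0)
  set y₁ : ZMod q × Fin 1 := (0, 0)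
  set y₂ : ZMod q × Fin 1 := (p, 0)
  set M := arcs q p r 1 with hM
  have h₁₁ : M x₁ y₁ := by
    simp only [hM, arcs, x₁, y₁, sub_neg_eq_add, zero_add, ZMod.val_one]
    omega
  have h₁₂ : ¬ M x₁ y₂ := by
    simp only [hM, arcs, x₁, y₂, sub_neg_eq_add, not_lt]
    rw [← Nat.cast_one, ← Nat.cast_add, ZMod.val_natCast_of_lt (by omega)]
    omega
  have h₂₁ : ¬ M x₂ y₁ := by
    simp only [hM, arcs, x₂, y₁]
    rw [val_neg_one' hq]
    omega
  have h₂₂ : M x₂ y₂ := by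
    simp only [hM, arcs, x₂, y₂]
    rw [val_sub_one_of_ne_zero hq hp0', hpv]
    omega
  refine ⟨switch M x₁ x₂ y₁ y₂, (arcs_isBiregular (by omega) (by omega)).switch h₁₁ h₂₂ h₁₂ h₂₁,
    not_areIsomorphic_of_twinCount (r := r) (fun x => twinCount_arcs one_pos (by omega) (by omega) x)
      (x := x₂) ?_⟩
  have h0 : ∀ y, M (0, 0) y ↔ switch M x₁ x₂ y₁ y₂ x₂ y := by
    intro y
    rw [switch_of_mem M y₁ y₂ (Or.inr rfl)]
    by_cases hy1 : y = y₁
    · rw [hy1, Equiv.swap_apply_left]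
      simp only [h₂₂, iff_true]
      simp only [hM, arcs, y₁, sub_zero, ZMod.val_zero]
      omega
    by_cases hy2 : y = y₂
    · rw [hy2, Equiv.swap_apply_right]
      simp only [h₂₁, iff_false]
      simp [hM, arcs, y₂, sub_zero, hpv]
    rw [Equiv.swap_apply_of_ne_of_ne hy1 hy2]
    have hne0 : y.1 ≠ 0 := fun h => hy1 (Prod.ext h (Subsingleton.elim _ _))
    have hnep : y.1 ≠ p := fun h => hy2 (Prod.ext h (Subsingleton.elim _ _))
    have hv0 : y.1.val ≠ 0 := by rwa [Ne, ZMod.val_eq_zero]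
    have hvp : y.1.val ≠ p := fun h => hnep (by rw [← h, ZMod.natCast_zmod_val])
    simp only [hM, arcs, x₂, sub_zero]
    rw [val_sub_one_of_ne_zero hq hne0]
    omega
  have hsub : insert x₂ (({0} : Set (ZMod q)) ×ˢ (Set.univ : Set (Fin r))) ⊆
      {x' | ∀ y, switch M x₁ x₂ y₁ y₂ x' y ↔ switch M x₁ x₂ y₁ y₂ x₂ y} := by
    rintro x' (rfl | ⟨hx', -⟩) y
    · rfl
    · rw [← h0, switch_of_ne]
      · simp only [hM, arcs, Set.mem_singleton_iff.1 hx']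
      · rintro rfl
        exact neg_ne_zero.2 one_ne_zero (Set.mem_singleton_iff.1 hx')
      · rintro rfl
        exact one_ne_zero (Set.mem_singleton_iff.1 hx')
  have := Set.ncard_le_ncard hsub
  rw [Set.ncard_insert_of_notMem (by simp [x₂]), Set.ncard_prod, Set.ncard_singleton,
    Set.ncard_univ, Nat.card_fin, one_mul] at this
  exact fun h => by
    rw [twinCount] at h
    omega

lemma IsBiregular.flip {M : X → Y → Prop} {a b : ℕ} (h : IsBiregular M a b) :
    IsBiregular (fun y x => M x y) b a := ⟨h.2, h.1⟩

lemma IsBiregular.comp {X' Y' : Type*} {M : X → Y → Prop} {a b : ℕ} (h : IsBiregular M a b)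
    (e : X' ≃ X) (f : Y' ≃ Y) : IsBiregular (fun x y => M (e x) (f y)) a b := by
  constructor
  · intro x
    rw [← h.1 (e x), ← Set.ncard_image_of_injective _ f.injective]
    congr 1
    ext y
    exact ⟨by rintro ⟨z, hz, rfl⟩; exact hz, fun h => ⟨f.symm y, by simpa using h, by simp⟩⟩
  · intro y
    rw [← h.2 (f y), ← Set.ncard_image_of_injective _ e.injective]
    congr 1
    ext x
    exact ⟨by rintro ⟨z, hz, rfl⟩; exact hz, fun h => ⟨e.symm x, by simpa using h, by simp⟩⟩

/-- Degrees and side sizes for which there are non-isomorphic biregular bipartite graphs. -/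
theorem exists_isBiregular_not_areIsomorphic [Finite X] [Finite Y] {a b : ℕ}
    (hab : Nat.card X * a = Nat.card Y * b) (ha : 2 ≤ a) (ha' : a + 2 ≤ Nat.card Y)
    (hb : 2 ≤ b) (hb' : b + 2 ≤ Nat.card X) :
    ∃ M N : X → Y → Prop, IsBiregular M a b ∧ IsBiregular N a b ∧ ¬ AreIsomorphic M N := by
  -- With `q` the gcd of the side sizes, the double count forces `a = p * s` and `b = p * r`, which
  -- are the degrees of `arcs q p r s`.
  obtain ⟨q, r, s, hq, hcop, hn, hm⟩ : ∃ q r s, 0 < q ∧ Nat.Coprime r s ∧ Nat.card X = q * r ∧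
      Nat.card Y = q * s := by
    obtain ⟨g, r, s, h1, h2, h3, h4⟩ := Nat.exists_coprime' (m := Nat.card X) (n := Nat.card Y)
      (Nat.gcd_pos_of_pos_left _ (by omega))
    exact ⟨g, r, s, h1, h2, by rw [h3, mul_comm], by rw [h4, mul_comm]⟩
  have hr0 : r ≠ 0 := by rintro rfl; omega
  have hs0 : s ≠ 0 := by rintro rfl; omega
  rw [hn, hm, mul_assoc, mul_assoc] at hab
  have hab' := Nat.eq_of_mul_eq_mul_left hq hab
  obtain ⟨p, rfl⟩ : s ∣ a := hcop.symm.dvd_of_dvd_mul_left (Dvd.intro _ hab'.symm)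
  obtain rfl : b = p * r := by
    apply Nat.eq_of_mul_eq_mul_left (Nat.pos_of_ne_zero hs0)
    rw [← hab']; ring
  have : NeZero q := ⟨hq.ne'⟩
  have eX : Nonempty (X ≃ ZMod q × Fin r) := Finite.card_eq.1 (by simp [hn])
  have eY : Nonempty (Y ≃ ZMod q × Fin s) := Finite.card_eq.1 (by simp [hm])
  obtain ⟨eX⟩ := eX
  obtain ⟨eY⟩ := eY
  have hp0 : 0 < p := Nat.pos_of_ne_zero (by rintro rfl; omega)
  have hpq : p < q := by
    by_contra! h
    have := Nat.mul_le_mul_right r h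
    omega
  suffices h : ∃ M N : ZMod q × Fin r → ZMod q × Fin s → Prop,
      IsBiregular M (p * s) (p * r) ∧ IsBiregular N (p * s) (p * r) ∧ ¬ AreIsomorphic M N by
    obtain ⟨M, N, hM, hN, hMN⟩ := h
    rw [mul_comm s p]
    refine ⟨_, _, hM.comp eX eY, hN.comp eX eY, ?_⟩
    rintro ⟨f, g, h⟩
    refine hMN ⟨(eX.symm.trans f).trans eX, (eY.symm.trans g).trans eY, fun x y => ?_⟩
    simpa using h (eX.symm x) (eY.symm y)
  have hbase : IsBiregular (arcs q p r s) (p * s) (p * r) := arcs_isBiregular hq hpq.le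
  rcases Nat.lt_or_ge s 2 with hs | hs
  · obtain rfl : s = 1 := by omega
    obtain ⟨N, hN, hN'⟩ := exists_switch_arcs_of_eq_one (r := r) (p := p) (q := q)
      (by omega) (by omega) (by omega)
    exact ⟨_, N, hbase, hN, hN'⟩
  rcases Nat.lt_or_ge r 2 with hr | hr
  · obtain rfl : r = 1 := by omega
    obtain ⟨N, hN, hN'⟩ := exists_switch_arcs_of_eq_one (r := s) (p := p) (q := q)
      (by omega) (by omega) (by omega)
    refine ⟨_, _, (arcs_isBiregular hq hpq.le (r := s) (s := 1)).flip, hN.flip, ?_⟩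
    rintro ⟨f, g, h⟩
    exact hN' ⟨g, f, fun x y => h y x⟩
  · obtain ⟨N, hN, hN'⟩ := exists_switch_arcs_of_two_le hr hs hp0 hpq
    exact ⟨_, N, hbase, hN, hN'⟩

end Biregular

/-! ### What the graph on one pair of cells and the graph on the others can determine -/

section Local

variable {V : Type u} {G : SimpleGraph V}

lemma cellOf_eq_iff {u v : V} : cellOf G u = cellOf G v ↔ stablePartition G u v := Quotient.eq

lemma Cell.exists_cellOf_eq (X : Cell G) : ∃ v, cellOf G v = X := Quotient.exists_rep X

lemma ncard_adj_cell_eq [Finite V] {u v : V} (h : cellOf G u = cellOf G v) (Z : Cell G) :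
    {w | G.Adj u w ∧ cellOf G w = Z}.ncard = {w | G.Adj v w ∧ cellOf G w = Z}.ncard := by
  obtain ⟨z, rfl⟩ := Z.exists_cellOf_eq
  simp_rw [cellOf_eq_iff]
  exact stablePartition_equitable G (cellOf_eq_iff.1 h) z

/-- `φ` is a cell-preserving permutation of the vertices that preserves the induced graphs on the
pairs of cells in `E`. -/
def Preserves (E : Set (Sym2 (Cell G))) (φ : Equiv.Perm V) : Prop :=
  (∀ v, cellOf G (φ v) = cellOf G v) ∧
    ∀ u v, s(cellOf G u, cellOf G v) ∈ E → (G.Adj (φ u) (φ v) ↔ G.Adj u v)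

lemma Preserves.mono {E F : Set (Sym2 (Cell G))} (h : E ⊆ F) {φ : Equiv.Perm V}
    (hφ : Preserves F φ) : Preserves E φ := ⟨hφ.1, fun u v huv => hφ.2 u v (h huv)⟩

lemma cellOf_symm_apply {φ : Equiv.Perm V} (hφ : ∀ v, cellOf G (φ v) = cellOf G v) (v : V) :
    cellOf G (φ.symm v) = cellOf G v := by
  rw [← hφ, φ.apply_symm_apply]

/-- Replacing the graph between one pair of cells by another one with the same degrees does not
change the isomorphism type. -/
lemma IsAmenable.exists_preserves [Finite V] (hG : IsAmenable G) (e : Sym2 (Cell G))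
    (H : SimpleGraph V) (hH : ∀ u v, s(cellOf G u, cellOf G v) ≠ e → (H.Adj u v ↔ G.Adj u v))
    (hdeg : ∀ u Z, s(cellOf G u, Z) = e →
      {w | H.Adj u w ∧ cellOf G w = Z}.ncard = {w | G.Adj u w ∧ cellOf G w = Z}.ncard) :
    ∃ φ : Equiv.Perm V, Preserves {e}ᶜ φ ∧ ∀ u v, H.Adj (φ u) (φ v) ↔ G.Adj u v := by
  obtain ⟨φ, hφ, h⟩ := hG.exists_perm H fun u z => by
    simp_rw [← cellOf_eq_iff]
    by_cases hz : s(cellOf G u, cellOf G z) = e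
    · exact hdeg u _ hz
    · congr 1
      ext w
      simp only [Set.mem_ofPred_eq]
      exact and_congr_left fun hw => hH u w (by rwa [hw])
  refine ⟨φ, ⟨hφ, fun u v huv => ?_⟩, h⟩
  rw [← h u v, hH]
  simpa [hφ] using huv

/-- Pulling back `G` along `σ` on the pair `e` alone keeps all degrees. In other words, every
cell-preserving permutation factors as `ψ * φ⁻¹`, where `ψ` preserves the graph on `e` and `φ`
preserves the graphs on all other pairs. -/
lemma IsAmenable.exists_preserves_twist [Finite V] (hG : IsAmenable G) (e : Sym2 (Cell G))
    (σ : Equiv.Perm V) (hσ : ∀ v, cellOf G (σ v) = cellOf G v) :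
    ∃ φ : Equiv.Perm V, Preserves {e}ᶜ φ ∧ Preserves {e} (φ.trans σ) := by
  let H : SimpleGraph V :=
    { Adj := fun u v => (s(cellOf G u, cellOf G v) = e ∧ G.Adj (σ u) (σ v)) ∨
        (s(cellOf G u, cellOf G v) ≠ e ∧ G.Adj u v)
      symm := ⟨fun u v h => by
        rw [Sym2.eq_swap, G.adj_comm, G.adj_comm v u]
        exact h⟩
      loopless := ⟨fun u h => by simp at h⟩ }
  obtain ⟨φ, hφ, h⟩ := hG.exists_preserves e H
    (fun u v huv => by simp [H, huv]) fun u Z hZ => by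
      rw [← ncard_adj_cell_eq (hσ u) Z, ← Set.ncard_image_of_injective _ σ.injective]
      congr 1
      ext w
      simp only [Set.mem_image, Set.mem_ofPred_eq]
      constructor
      · rintro ⟨x, ⟨hx, rfl⟩, rfl⟩
        exact ⟨by simpa [H, hZ] using hx, hσ x⟩
      · rintro ⟨h1, rfl⟩
        refine ⟨σ.symm w, ⟨Or.inl ⟨?_, by simpa using h1⟩, ?_⟩, by simp⟩ <;>
        simp [cellOf_symm_apply hσ, hZ]
  refine ⟨φ, hφ, fun v => by simp [hσ, hφ.1], fun u v huv => ?_⟩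
  rw [← h u v]
  simp only [Set.mem_singleton_iff] at huv
  simp [H, hφ.1, huv]

/-- There is a bijection between the cells `X` and `Y` that commutes with all permutations that
preserve the graphs on the pairs in `E`. -/
def Linked (E : Set (Sym2 (Cell G))) (X Y : Cell G) : Prop :=
  ∃ β : Equiv.Perm V, (∀ v, cellOf G (β v) = Y ↔ cellOf G v = X) ∧
    ∀ φ, Preserves E φ → ∀ v, cellOf G v = X → β (φ v) = φ (β v)

lemma Linked.refl (E : Set (Sym2 (Cell G))) (X : Cell G) : Linked E X X :=
  ⟨1, fun _ => Iff.rfl, fun _ _ _ _ => rfl⟩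

lemma Linked.mono {E F : Set (Sym2 (Cell G))} (h : E ⊆ F) {X Y : Cell G} (hL : Linked E X Y) :
    Linked F X Y := by
  obtain ⟨β, h1, h2⟩ := hL
  exact ⟨β, h1, fun φ hφ => h2 φ (hφ.mono h)⟩

lemma Linked.symm {E : Set (Sym2 (Cell G))} {X Y : Cell G} (h : Linked E X Y) : Linked E Y X := by
  obtain ⟨β, h1, h2⟩ := h
  refine ⟨β.symm, fun v => by rw [← h1, β.apply_symm_apply], fun φ hφ v hv => ?_⟩
  rw [Equiv.symm_apply_eq, h2 φ hφ _ (by rwa [← h1, β.apply_symm_apply]), β.apply_symm_apply]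

lemma Linked.trans {E : Set (Sym2 (Cell G))} {X Y Z : Cell G} (h : Linked E X Y)
    (k : Linked E Y Z) : Linked E X Z := by
  obtain ⟨β, h1, h2⟩ := h
  obtain ⟨γ, k1, k2⟩ := k
  refine ⟨β.trans γ, fun v => (k1 _).trans (h1 v), fun φ hφ v hv => ?_⟩
  simp only [Equiv.trans_apply]
  rw [h2 φ hφ v hv, k2 φ hφ _ ((h1 v).2 hv)]

/-- There is a regular graph on the cell `Y`, neither empty nor complete, that is invariant under all
permutations that preserve the graphs on the pairs in `E`. -/
def HasInvariantGraph (E : Set (Sym2 (Cell G))) (Y : Cell G) : Prop :=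
  ∃ S : SimpleGraph V,
    (∀ φ, Preserves E φ → ∀ u v, cellOf G u = Y → cellOf G v = Y →
      (S.Adj (φ u) (φ v) ↔ S.Adj u v)) ∧
    (∀ u v, cellOf G u = Y → cellOf G v = Y →
      {w | S.Adj u w ∧ cellOf G w = Y}.ncard = {w | S.Adj v w ∧ cellOf G w = Y}.ncard) ∧
    (∃ u v, cellOf G u = Y ∧ cellOf G v = Y ∧ S.Adj u v) ∧
    ∃ u v, cellOf G u = Y ∧ cellOf G v = Y ∧ u ≠ v ∧ ¬ S.Adj u v

lemma HasInvariantGraph.mono {E F : Set (Sym2 (Cell G))} (h : E ⊆ F) {Y : Cell G}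
    (hY : HasInvariantGraph E Y) : HasInvariantGraph F Y := by
  obtain ⟨S, h1, h2⟩ := hY
  exact ⟨S, fun φ hφ => h1 φ (hφ.mono h), h2⟩

lemma HasInvariantGraph.of_linked {E : Set (Sym2 (Cell G))} {X Y : Cell G}
    (hX : HasInvariantGraph E X) (h : Linked E X Y) : HasInvariantGraph E Y := by
  obtain ⟨β, b1, b2⟩ := h.symm
  obtain ⟨S, h1, h2, ⟨u, v, hu, hv, huv⟩, u', v', hu', hv', hne, huv'⟩ := hX
  refine ⟨S.comap β, fun φ hφ u v hu hv => ?_, fun u v hu hv => ?_,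
    ⟨β.symm u, β.symm v, by simpa [← b1] using hu, by simpa [← b1] using hv, by simpa using huv⟩,
    β.symm u', β.symm v', by simpa [← b1] using hu', by simpa [← b1] using hv',
    by simpa using hne, by simpa using huv'⟩
  · simp only [SimpleGraph.comap_adj]
    rw [b2 φ hφ u hu, b2 φ hφ v hv, h1 φ hφ _ _ ((b1 _).2 hu) ((b1 _).2 hv)]
  · have key : ∀ u, {w | (S.comap β).Adj u w ∧ cellOf G w = Y}.ncard =
        {w | S.Adj (β u) w ∧ cellOf G w = X}.ncard := by
      intro u
      rw [← Set.ncard_image_of_injective _ β.injective]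
      congr 1
      ext w
      simp only [Set.mem_image, Set.mem_ofPred_eq, SimpleGraph.comap_adj]
      constructor
      · rintro ⟨x, ⟨hx, hxY⟩, rfl⟩
        exact ⟨hx, (b1 x).2 hxY⟩
      · rintro ⟨hw, hwX⟩
        exact ⟨β.symm w, ⟨by simpa using hw, by rw [← b1]; simpa using hwX⟩, by simp⟩
    rw [key, key, h2 _ _ ((b1 _).2 hu) ((b1 _).2 hv)]

lemma ncard_subtype_verts (p : V → Prop) (Y : Cell G) :
    {w : Y.verts | p w}.ncard = {w | p w ∧ cellOf G w = Y}.ncard := by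
  rw [← Set.ncard_image_of_injective _ Subtype.val_injective]
  congr 1
  ext w
  simp only [Set.mem_image, Set.mem_ofPred_eq, Subtype.exists, exists_and_left, exists_prop,
    exists_eq_right_right]
  rfl

lemma cellOf_ofSubtype {Y : Cell G} [DecidablePred (· ∈ Y.verts)] (σ : Equiv.Perm Y.verts) (v : V) :
    cellOf G (Equiv.Perm.ofSubtype σ v) = cellOf G v := by
  by_cases hv : v ∈ Y.verts
  · rw [Equiv.Perm.ofSubtype_apply_of_mem σ hv]
    exact (σ ⟨v, hv⟩).2.trans hv.symm
  · rw [Equiv.Perm.ofSubtype_apply_of_not_mem σ hv]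

/-- In an amenable graph, two disjoint sets of pairs of cells do not both determine a nontrivial
graph on the same cell, when one of the sets is a singleton. -/
lemma IsAmenable.not_hasInvariantGraph [Finite V] (hG : IsAmenable G) {e : Sym2 (Cell G)}
    {Y : Cell G} (h1 : HasInvariantGraph {e} Y) : ¬ HasInvariantGraph {e}ᶜ Y := by
  classical
  rintro ⟨S, s1, s2, ⟨u, v, hu, hv, huv⟩, u', v', hu', hv', hne, huv'⟩
  obtain ⟨T, t1, t2, ⟨a, b, ha, hb, hab⟩, a', b', ha', hb', hne', hab'⟩ := h1
  have := Fintype.ofFinite Y.verts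
  obtain ⟨σ, hσ⟩ := exists_perm_overlap_ne (S.induce Y.verts) (T.induce Y.verts)
    (fun x y => by
      simp only [SimpleGraph.induce_adj]
      rw [ncard_subtype_verts (fun w => S.Adj x w), ncard_subtype_verts (fun w => S.Adj y w)]
      exact s2 _ _ x.2 y.2)
    (fun x y => by
      simp only [SimpleGraph.induce_adj]
      rw [ncard_subtype_verts (fun w => T.Adj x w), ncard_subtype_verts (fun w => T.Adj y w)]
      exact t2 _ _ x.2 y.2)
    ⟨⟨u, hu⟩, ⟨v, hv⟩, huv⟩ ⟨⟨u', hu'⟩, ⟨v', hv'⟩, fun h => hne (congrArg Subtype.val h), huv'⟩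
    ⟨⟨a, ha⟩, ⟨b, hb⟩, hab⟩ ⟨⟨a', ha'⟩, ⟨b', hb'⟩, fun h => hne' (congrArg Subtype.val h), hab'⟩
  obtain ⟨φ, p1, p2⟩ := hG.exists_preserves_twist e (Equiv.Perm.ofSubtype σ) (cellOf_ofSubtype σ)
  apply hσ
  set ψ : Equiv.Perm Y.verts := φ.subtypePerm fun v => by
    simp only [Cell.verts, Set.mem_ofPred_eq, p1.1] with hψ
  rw [← Set.ncard_image_of_injective {p : Y.verts × Y.verts | (S.induce Y.verts).Adj p.1 p.2 ∧
    (T.induce Y.verts).Adj p.1 p.2} (Equiv.prodCongr ψ ψ).injective]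
  -- Since `φ` preserves `S` and `φ` followed by `σ` preserves `T`, the overlap of `S` with the
  -- displaced `T` equals the original overlap, for any `σ`.
  have hiff : ∀ x y : Y.verts, ((S.induce Y.verts).Adj (ψ x) (ψ y) ∧
      (T.induce Y.verts).Adj (σ (ψ x)) (σ (ψ y))) ↔
      ((S.induce Y.verts).Adj x y ∧ (T.induce Y.verts).Adj x y) := by
    intro x y
    refine and_congr (s1 φ p1 x y x.2 y.2) ?_
    have := t1 _ p2 x y x.2 y.2
    simp only [Equiv.trans_apply] at this
    rwa [show φ x = (ψ x : V) from rfl, show φ y = (ψ y : V) from rfl,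
      Equiv.Perm.ofSubtype_apply_coe, Equiv.Perm.ofSubtype_apply_coe] at this
  congr 1
  ext ⟨x, y⟩
  simp only [Set.mem_image, Set.mem_ofPred_eq, Prod.exists]
  constructor
  · intro h
    refine ⟨ψ.symm x, ψ.symm y, ?_, by simp⟩
    rw [← hiff]
    simpa only [ψ.apply_symm_apply] using h
  · rintro ⟨x', y', h, h'⟩
    obtain ⟨rfl, rfl⟩ := Prod.ext_iff.1 h'
    exact (hiff x' y').2 h

/-- In an amenable graph, a bijection between two cells of an anisotropic pair is not determined by
the graphs on the other pairs of cells. -/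
lemma IsAmenable.not_linked [Finite V] (hG : IsAmenable G) {X Y : Cell G} (hXY : X ≠ Y)
    (haniso : ¬ IsIsotropic G X Y) : ¬ Linked {s(X, Y)}ᶜ X Y := by
  classical
  rintro ⟨β, b1, b2⟩
  have := Fintype.ofFinite Y.verts
  rw [IsIsotropic, not_or, IsEmptyBetween, IsCompleteBetween] at haniso
  push Not at haniso
  obtain ⟨⟨x, hx, y, hy, hxy⟩, x', hx', y', hy', hxy'⟩ := haniso
  have bX : ∀ y : Y.verts, cellOf G (β.symm y) = X := fun y => by
    rw [← b1, β.apply_symm_apply]; exact y.2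
  -- Through `β` the bipartite graph becomes a relation on `Y`. The number of points of `Y` joined
  -- to their partner under `β` changes for a suitable displacement of `Y`.
  obtain ⟨σ, hσ⟩ := exists_perm_fixed_ne (fun y y' : Y.verts => G.Adj (β.symm y) y')
    (fun y y' => by
      rw [ncard_subtype_verts (fun w => G.Adj (β.symm y) w),
        ncard_subtype_verts (fun w => G.Adj (β.symm y') w)]
      exact ncard_adj_cell_eq ((bX y).trans (bX y').symm) Y)
    (fun y y' => by
      have key : ∀ y : Y.verts, {z : Y.verts | G.Adj (β.symm z) y}.ncard =
          {w | G.Adj y w ∧ cellOf G w = X}.ncard := by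
        intro y
        rw [← Set.ncard_image_of_injective _ (β.symm.injective.comp Subtype.val_injective)]
        congr 1
        ext w
        simp only [Set.mem_image, Set.mem_ofPred_eq, Function.comp_apply]
        constructor
        · rintro ⟨z, hz, rfl⟩
          exact ⟨hz.symm, bX z⟩
        · rintro ⟨hw, hwX⟩
          exact ⟨⟨β w, (b1 w).2 hwX⟩, by simpa using hw.symm, by simp⟩
      rw [key, key]
      exact ncard_adj_cell_eq (y.2.trans y'.2.symm) X)
    ⟨⟨β x, (b1 x).2 hx⟩, ⟨y, hy⟩, by simpa using hxy⟩
    ⟨⟨β x', (b1 x').2 hx'⟩, ⟨y', hy'⟩, by simpa using hxy'⟩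
  obtain ⟨φ, p1, p2⟩ := hG.exists_preserves_twist s(X, Y) (Equiv.Perm.ofSubtype σ)
    (cellOf_ofSubtype σ)
  apply hσ
  set ψ : Equiv.Perm Y.verts := φ.subtypePerm fun v => by
    simp only [Cell.verts, Set.mem_ofPred_eq, p1.1] with hψ
  rw [← Set.ncard_image_of_injective {x : Y.verts | G.Adj (β.symm x) x} ψ.injective]
  -- The map `φ` commutes with `β`, and `σ` is the identity on `X`; so the displaced count is equal
  -- to the original one.
  have hiff : ∀ y : Y.verts, G.Adj (β.symm (ψ y)) (σ (ψ y)) ↔ G.Adj (β.symm y) y := by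
    intro y
    have e1 : φ (β.symm y) = β.symm (ψ y) := by
      rw [Equiv.eq_symm_apply, b2 φ p1 _ (bX y), β.apply_symm_apply]
      rfl
    rw [← p2.2 (β.symm y) y (by rw [bX y, show cellOf G (y : V) = Y from y.2]; rfl)]
    simp only [Equiv.trans_apply]
    rw [e1, show φ y = (ψ y : V) from rfl, Equiv.Perm.ofSubtype_apply_coe,
      Equiv.Perm.ofSubtype_apply_of_not_mem]
    exact fun h => hXY ((bX (ψ y)).symm.trans h)
  congr 1
  ext y
  simp only [Set.mem_image, Set.mem_ofPred_eq]
  constructor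
  · intro h
    refine ⟨ψ.symm y, ?_, by simp⟩
    rw [← hiff]
    simpa only [ψ.apply_symm_apply] using h
  · rintro ⟨z, hz, rfl⟩
    exact (hiff z).2 hz

end Local

/-! ### Anisotropic pairs are stars or co-stars -/

section Stars

lemma IsBiregular.card_mul {X Y : Type*} [Finite X] [Finite Y] {M : X → Y → Prop} {a b : ℕ}
    (h : IsBiregular M a b) : Nat.card X * a = Nat.card Y * b := by
  classical
  have := Fintype.ofFinite X
  have := Fintype.ofFinite Y
  rw [Nat.card_eq_fintype_card, Nat.card_eq_fintype_card]
  refine Finset.card_mul_eq_card_mul (s := Finset.univ) (t := Finset.univ) M (fun x _ => ?_)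
    fun y _ => ?_
  · rw [← h.1 x, Set.ncard_eq_toFinset_card', Set.toFinset_ofPred, Finset.bipartiteAbove]
  · rw [← h.2 y, Set.ncard_eq_toFinset_card', Set.toFinset_ofPred, Finset.bipartiteBelow]

lemma IsBiregular.compl {X Y : Type*} [Finite X] [Finite Y] {M : X → Y → Prop} {a b : ℕ}
    (h : IsBiregular M a b) :
    IsBiregular (fun x y => ¬ M x y) (Nat.card Y - a) (Nat.card X - b) := by
  constructor
  · intro x
    rw [← h.1 x, ← Set.ncard_compl]
    rfl
  · intro y
    rw [← h.2 y, ← Set.ncard_compl]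
    rfl

variable {V : Type u}

lemma ncard_subtype_mem (p : V → Prop) (Y : Set V) :
    {w : Y | p w}.ncard = {w | w ∈ Y ∧ p w}.ncard := by
  rw [← Set.ncard_image_of_injective _ Subtype.val_injective]
  congr 1
  ext w
  simp [and_comm]

lemma isStarsFrom_iff {adj : V → V → Prop} {X Y : Set V} : IsStarsFrom adj X Y ↔
    ∃ t, 1 ≤ t ∧ IsBiregular (fun (x : X) (y : Y) => adj x y) t 1 := by
  refine exists_congr fun t => and_congr_right fun _ => and_congr ?_ ?_
  · simp_rw [fun x => ncard_subtype_mem (adj x) Y, Subtype.forall]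
  · simp_rw [fun y => ncard_subtype_mem (fun x => adj x y) X, Subtype.forall, Set.ncard_eq_one]
    refine forall₂_congr fun y _ => exists_congr fun x => ?_
    simp only [Set.ext_iff, Set.mem_ofPred_eq, Set.mem_singleton_iff]
    constructor
    · rintro ⟨h1, h2⟩ z
      exact ⟨h2 z, by rintro rfl; exact h1⟩
    · exact fun h => ⟨(h x).2 rfl, fun z => (h z).1⟩

/-- There are at least as many leaves as centers, so `X.ncard ≤ Y.ncard` forces a perfect matching,
in which either side may serve as the centers. -/
lemma IsStarsFrom.flip [Finite V] {adj : V → V → Prop} (hadj : ∀ u v, adj u v ↔ adj v u)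
    {X Y : Set V} (h : IsStarsFrom adj Y X) (hY : Y.Nonempty) (hXY : X.ncard ≤ Y.ncard) :
    IsStarsFrom adj X Y := by
  obtain ⟨t, ht, hb⟩ := isStarsFrom_iff.1 h
  have := hb.card_mul
  rw [Nat.card_coe_set_eq, Nat.card_coe_set_eq, mul_one] at this
  have hpos := hY.ncard_pos
  obtain rfl : t = 1 := by
    by_contra hne
    have : Y.ncard * 2 ≤ Y.ncard * t := Nat.mul_le_mul_left _ (by omega)
    omega
  refine isStarsFrom_iff.2 ⟨1, le_rfl, ?_⟩
  rw [show (fun (x : X) (y : Y) => adj x y) = fun (x : X) (y : Y) => adj y x from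
    funext₂ fun _ _ => propext (hadj _ _)]
  exact hb.flip

variable {G : SimpleGraph V}

lemma Cell.verts_nonempty (X : Cell G) : X.verts.Nonempty := X.exists_cellOf_eq

/-- Replacing `G[X, Y]` by `M` keeps every degree into a cell, so amenability supplies an
isomorphism that restricts to `X` and to `Y`. -/
lemma IsAmenable.areIsomorphic [Finite V] (hG : IsAmenable G) {X Y : Cell G} (hXY : X ≠ Y)
    {a b : ℕ} (h₀ : IsBiregular (fun (x : X.verts) (y : Y.verts) => G.Adj x y) a b)
    {M : X.verts → Y.verts → Prop} (hM : IsBiregular M a b) :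
    AreIsomorphic (fun (x : X.verts) (y : Y.verts) => G.Adj x y) M := by
  let H : SimpleGraph V :=
    { Adj := fun u v => (∃ (hu : u ∈ X.verts) (hv : v ∈ Y.verts), M ⟨u, hu⟩ ⟨v, hv⟩) ∨
        (∃ (hu : u ∈ Y.verts) (hv : v ∈ X.verts), M ⟨v, hv⟩ ⟨u, hu⟩) ∨
        (s(cellOf G u, cellOf G v) ≠ s(X, Y) ∧ G.Adj u v)
      symm := ⟨by
        rintro u v (⟨h1, h2, h⟩ | ⟨h1, h2, h⟩ | h)
        · exact Or.inr (Or.inl ⟨h2, h1, h⟩)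
        · exact Or.inl ⟨h2, h1, h⟩
        · rw [Sym2.eq_swap] at h
          exact Or.inr (Or.inr ⟨h.1, h.2.symm⟩)⟩
      loopless := ⟨by
        rintro u (⟨h1, h2, -⟩ | ⟨h1, h2, -⟩ | ⟨-, h⟩)
        · exact hXY (h1.symm.trans h2)
        · exact hXY (h2.symm.trans h1)
        · exact G.loopless.irrefl _ h⟩ }
  have hHXY : ∀ (x : X.verts) (y : Y.verts), H.Adj x y ↔ M x y := by
    intro x y
    refine ⟨?_, fun h => Or.inl ⟨x.2, y.2, h⟩⟩
    rintro (⟨h1, h2, h⟩ | ⟨h1, h2, h⟩ | ⟨h, -⟩)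
    · exact h
    · exact (hXY (x.2.symm.trans h1)).elim
    · rw [show cellOf G (x : V) = X from x.2, show cellOf G (y : V) = Y from y.2] at h
      exact (h rfl).elim
  obtain ⟨φ, hφ, h⟩ := hG.exists_preserves s(X, Y) H (fun u v huv => by
      refine ⟨?_, fun h => Or.inr (Or.inr ⟨huv, h⟩)⟩
      rintro (⟨h1, h2, h⟩ | ⟨h1, h2, h⟩ | ⟨-, h⟩)
      · exact (huv (by rw [show _ = _ from h1, show _ = _ from h2])).elim
      · exact (huv (by rw [show _ = _ from h1, show _ = _ from h2, Sym2.eq_swap])).elim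
      · exact h) fun u Z huZ => by
    rw [← ncard_subtype_verts, ← ncard_subtype_verts]
    rcases Sym2.eq_iff.1 huZ with ⟨hu, rfl⟩ | ⟨hu, rfl⟩
    · simp_rw [hHXY ⟨u, hu⟩]
      rw [hM.1, ← h₀.1 ⟨u, hu⟩]
    · simp_rw [H.adj_comm u, G.adj_comm u, hHXY _ ⟨u, hu⟩]
      rw [hM.2, ← h₀.2 ⟨u, hu⟩]
  refine ⟨φ.subtypePerm fun v => ?_, φ.subtypePerm fun v => ?_, fun x y => ?_⟩
  · simp only [Cell.verts, Set.mem_ofPred_eq, hφ.1]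
  · simp only [Cell.verts, Set.mem_ofPred_eq, hφ.1]
  · rw [← hHXY]
    exact h x y

lemma exists_isBiregular [Finite V] (X Y : Cell G) :
    ∃ a b, IsBiregular (fun (x : X.verts) (y : Y.verts) => G.Adj x y) a b := by
  obtain ⟨x, hx⟩ := X.exists_cellOf_eq
  obtain ⟨y, hy⟩ := Y.exists_cellOf_eq
  refine ⟨{w | G.Adj x w ∧ cellOf G w = Y}.ncard, {w | G.Adj y w ∧ cellOf G w = X}.ncard,
    fun x' => ?_, fun y' => ?_⟩
  · rw [ncard_subtype_verts]
    exact ncard_adj_cell_eq (x'.2.trans hx.symm) Y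
  · rw [ncard_subtype_verts (fun x => G.Adj x y')]
    simp_rw [G.adj_comm _ (y' : V)]
    exact ncard_adj_cell_eq (y'.2.trans hy.symm) X

/-- In an amenable graph, an anisotropic pair of cells induces a disjoint union of stars or the
bipartite complement of such a graph, with all centers in the smaller cell. -/
theorem IsAmenable.isStarsFrom [Finite V] (hG : IsAmenable G) {X Y : Cell G} (hXY : X ≠ Y)
    (haniso : ¬ IsIsotropic G X Y) (hle : X.size ≤ Y.size) :
    IsStarsFrom G.Adj X.verts Y.verts ∨ IsStarsFrom (fun a b => ¬ G.Adj a b) X.verts Y.verts := by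
  obtain ⟨a, b, h₀⟩ := exists_isBiregular X Y
  have hcX : Nat.card X.verts = X.size := Nat.card_coe_set_eq _
  have hcY : Nat.card Y.verts = Y.size := Nat.card_coe_set_eq _
  have hmul := h₀.card_mul
  have hcompl := h₀.compl
  rw [hcX, hcY] at hcompl
  have hmul' := hcompl.card_mul
  rw [hcX, hcY] at hmul hmul'
  rw [IsIsotropic, not_or, IsEmptyBetween, IsCompleteBetween] at haniso
  push Not at haniso
  obtain ⟨⟨x, hx, y, hy, hxy⟩, x', hx', y', hy', hxy'⟩ := haniso
  have ha : 1 ≤ a := by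
    rw [← h₀.1 ⟨x, hx⟩]
    exact (Set.ncard_pos (Set.toFinite _)).2 ⟨⟨y, hy⟩, hxy⟩
  have hb : 1 ≤ b := by
    rw [← h₀.2 ⟨y, hy⟩]
    exact (Set.ncard_pos (Set.toFinite _)).2 ⟨⟨x, hx⟩, hxy⟩
  have ha' : 1 ≤ Y.size - a := by
    rw [← hcompl.1 ⟨x', hx'⟩]
    exact (Set.ncard_pos (Set.toFinite _)).2 ⟨⟨y', hy'⟩, hxy'⟩
  have hb' : 1 ≤ X.size - b := by
    rw [← hcompl.2 ⟨y', hy'⟩]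
    exact (Set.ncard_pos (Set.toFinite _)).2 ⟨⟨x', hx'⟩, hxy'⟩
  by_cases hb1 : b = 1
  · exact Or.inl (isStarsFrom_iff.2 ⟨a, ha, hb1 ▸ h₀⟩)
  by_cases hb2 : X.size - b = 1
  · exact Or.inr (isStarsFrom_iff.2 ⟨_, ha', hb2 ▸ hcompl⟩)
  by_cases ha1 : a = 1
  · refine Or.inl (IsStarsFrom.flip (fun u v => G.adj_comm u v) (isStarsFrom_iff.2 ⟨b, hb, ?_⟩)
      Y.verts_nonempty hle)
    rw [show (fun (y : Y.verts) (x : X.verts) => G.Adj y x) =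
        fun (y : Y.verts) (x : X.verts) => G.Adj x y from
      funext₂ fun _ _ => propext (G.adj_comm _ _)]
    exact ha1 ▸ h₀.flip
  by_cases ha2 : Y.size - a = 1
  · refine Or.inr (IsStarsFrom.flip (fun u v => not_congr (G.adj_comm u v))
      (isStarsFrom_iff.2 ⟨X.size - b, hb', ?_⟩) Y.verts_nonempty hle)
    rw [show (fun (y : Y.verts) (x : X.verts) => ¬ G.Adj y x) =
        fun (y : Y.verts) (x : X.verts) => ¬ G.Adj x y from
      funext₂ fun _ _ => propext (not_congr (G.adj_comm _ _))]
    exact ha2 ▸ hcompl.flip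
  -- Now all degrees and codegrees are at least 2. Two non-isomorphic graphs with these degrees
  -- would both be isomorphic to `G[X, Y]`.
  obtain ⟨M, N, hM, hN, hMN⟩ := exists_isBiregular_not_areIsomorphic (X := X.verts) (Y := Y.verts)
    (a := a) (b := b) (by rw [hcX, hcY, hmul]) (by omega) (by rw [hcY]; omega) (by omega)
    (by rw [hcX]; omega)
  obtain ⟨f, g, h⟩ := hG.areIsomorphic hXY h₀ hM
  obtain ⟨f', g', h'⟩ := hG.areIsomorphic hXY h₀ hN
  exact (hMN ⟨f.symm.trans f', g.symm.trans g', fun x y => by simp [h', ← h]⟩).elim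

/-- The stars or co-stars between `X` and `Y` are given by a relation that is preserved by all
permutations that preserve `G[X, Y]`. -/
lemma IsAmenable.exists_isStarsFrom [Finite V] (hG : IsAmenable G) {X Y : Cell G} (hXY : X ≠ Y)
    (haniso : ¬ IsIsotropic G X Y) (hle : X.size ≤ Y.size) :
    ∃ adj : V → V → Prop, IsStarsFrom adj X.verts Y.verts ∧
      ∀ φ, Preserves {s(X, Y)} φ → ∀ u v, cellOf G u = X → cellOf G v = Y →
        (adj (φ u) (φ v) ↔ adj u v) := by
  have key : ∀ φ, Preserves {s(X, Y)} φ → ∀ u v, cellOf G u = X → cellOf G v = Y →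
      (G.Adj (φ u) (φ v) ↔ G.Adj u v) := fun φ hφ u v hu hv => hφ.2 u v (by rw [hu, hv]; rfl)
  rcases hG.isStarsFrom hXY haniso hle with h | h
  · exact ⟨_, h, key⟩
  · exact ⟨_, h, fun φ hφ u v hu hv => not_congr (key φ hφ u v hu hv)⟩

/-- Between cells of equal size the stars are single edges, and the resulting perfect matching is
the bijection. -/
lemma IsAmenable.linked_of_size_eq [Finite V] (hG : IsAmenable G) {X Y : Cell G} (hXY : X ≠ Y)
    (haniso : ¬ IsIsotropic G X Y) (hsize : X.size = Y.size) : Linked {s(X, Y)} X Y := by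
  classical
  have := Fintype.ofFinite V
  obtain ⟨adj, hstar, hadj⟩ := hG.exists_isStarsFrom hXY haniso hsize.le
  obtain ⟨t, ht, hb⟩ := isStarsFrom_iff.1 hstar
  obtain rfl : t = 1 := by
    have := hb.card_mul
    rw [Nat.card_coe_set_eq, Nat.card_coe_set_eq,
      show X.verts.ncard = Y.verts.ncard from hsize] at this
    exact Nat.eq_of_mul_eq_mul_left Y.verts_nonempty.ncard_pos this
  have huniq := hb.1
  simp_rw [Set.ncard_eq_one] at huniq
  choose f hf using huniq
  have hf' : ∀ (x : X.verts) (y : Y.verts), adj x y ↔ y = f x := fun x y => Set.ext_iff.1 (hf x) y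
  have hinj : Function.Injective f := by
    intro x x' hxx'
    obtain ⟨z, hz⟩ := Set.ncard_eq_one.1 (hb.2 (f x))
    have h1 : x ∈ ({z} : Set X.verts) := hz.subset ((hf' x _).2 rfl)
    have h2 : x' ∈ ({z} : Set X.verts) := hz.subset ((hf' x' _).2 hxx')
    rw [Set.mem_singleton_iff.1 h1, Set.mem_singleton_iff.1 h2]
  have hbij : Function.Bijective f :=
    (Nat.bijective_iff_injective_and_card f).2 ⟨hinj, by
      rw [Nat.card_coe_set_eq, Nat.card_coe_set_eq]; exact hsize⟩
  set e : {v // v ∈ X.verts} ≃ {v // v ∈ Y.verts} := Equiv.ofBijective f hbij with he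
  refine ⟨e.extendSubtype, fun v => ?_, fun φ hφ v hv => ?_⟩
  · by_cases hv : v ∈ X.verts
    · exact iff_of_true (e.extendSubtype_mem v hv) hv
    · exact iff_of_false (e.extendSubtype_not_mem v hv) hv
  · have hφv : φ v ∈ X.verts := (hφ.1 v).trans hv
    rw [e.extendSubtype_apply_of_mem v hv, e.extendSubtype_apply_of_mem _ hφv]
    have h1 := (hadj φ hφ v (f ⟨v, hv⟩) hv (f ⟨v, hv⟩).2).2 ((hf' ⟨v, hv⟩ _).2 rfl)
    exact congrArg Subtype.val
      ((hf' ⟨φ v, hφv⟩ ⟨φ (f ⟨v, hv⟩), (hφ.1 _).trans (f ⟨v, hv⟩).2⟩).1 h1).symm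

/-- Having the same center is an equivalence relation on the leaves. Its classes have `t ≥ 2`
elements because `Y` is larger, and there are several classes because a pair with a single center
would be isotropic. -/
lemma IsAmenable.hasInvariantGraph_of_size_lt [Finite V] (hG : IsAmenable G) {X Y : Cell G}
    (haniso : ¬ IsIsotropic G X Y) (hsize : X.size < Y.size) :
    HasInvariantGraph {s(X, Y)} Y := by
  have hXY : X ≠ Y := by rintro rfl; exact lt_irrefl _ hsize
  obtain ⟨adj, hstar, hadj⟩ := hG.exists_isStarsFrom hXY haniso hsize.le
  obtain ⟨t, ht, hb⟩ := isStarsFrom_iff.1 hstar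
  have hcard := hb.card_mul
  rw [Nat.card_coe_set_eq, Nat.card_coe_set_eq, mul_one] at hcard
  have ht2 : 2 ≤ t := by
    by_contra! h
    obtain rfl : t = 1 := by omega
    rw [mul_one] at hcard
    exact hsize.ne hcard
  obtain ⟨t', -, hdeg, hcenter⟩ := hstar
  obtain rfl : t' = t := by
    obtain ⟨x, hx⟩ := X.verts_nonempty
    rw [← hdeg x hx, ← hb.1 ⟨x, hx⟩, ncard_subtype_mem]
  let S : SimpleGraph V :=
    { Adj := fun u v => u ≠ v ∧ ∀ z, cellOf G z = X → (adj z u ↔ adj z v)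
      symm := ⟨fun u v h => ⟨h.1.symm, fun z hz => (h.2 z hz).symm⟩⟩
      loopless := ⟨fun u h => h.1 rfl⟩ }
  have hS : ∀ x u v, cellOf G x = X → cellOf G u = Y → cellOf G v = Y → adj x u →
      (S.Adj u v ↔ u ≠ v ∧ adj x v) := by
    intro x u v hx hu hv hxu
    refine and_congr_right fun _ => ⟨fun h => (h x hx).1 hxu, fun hxv z hz => ?_⟩
    obtain ⟨c, -, hc⟩ := hcenter u hu
    obtain ⟨d, -, hd⟩ := hcenter v hv
    constructor
    · intro hzu
      rwa [hc z ⟨hz, hzu⟩, ← hc x ⟨hx, hxu⟩]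
    · intro hzv
      rwa [hd z ⟨hz, hzv⟩, ← hd x ⟨hx, hxv⟩]
  have hleaf : ∀ x, cellOf G x = X → ∃ u v, cellOf G u = Y ∧ cellOf G v = Y ∧ u ≠ v ∧
      adj x u ∧ adj x v := by
    intro x hx
    have h1 : 1 < {y | y ∈ Y.verts ∧ adj x y}.ncard := by rw [hdeg x hx]; omega
    obtain ⟨u, hu, v, hv, huv⟩ := (Set.one_lt_ncard (Set.toFinite _)).1 h1
    exact ⟨u, v, hu.1, hv.1, huv, hu.2, hv.2⟩
  refine ⟨S, fun φ hφ u v hu hv => ?_, ?_, ?_, ?_⟩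
  · refine and_congr φ.injective.ne_iff ⟨fun h z hz => ?_, fun h z hz => ?_⟩
    · rw [← hadj φ hφ z u hz hu, ← hadj φ hφ z v hz hv]
      exact h _ ((hφ.1 z).trans hz)
    · have hz' : cellOf G (φ.symm z) = X := (cellOf_symm_apply hφ.1 z).trans hz
      have h1 := hadj φ hφ _ u hz' hu
      have h2 := hadj φ hφ _ v hz' hv
      rw [φ.apply_symm_apply] at h1 h2
      rw [h1, h2]
      exact h _ hz'
  · suffices h : ∀ u, cellOf G u = Y → {w | S.Adj u w ∧ cellOf G w = Y}.ncard = t' - 1 from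
      fun u v hu hv => (h u hu).trans (h v hv).symm
    intro u hu
    obtain ⟨x, ⟨hx, hxu⟩, -⟩ := hcenter u hu
    rw [← hdeg x hx, ← Set.ncard_sdiff_singleton_of_mem
      (show u ∈ {y | y ∈ Y.verts ∧ adj x y} from ⟨hu, hxu⟩)]
    congr 1
    ext w
    simp only [Set.mem_ofPred_eq, Set.mem_sdiff, Set.mem_singleton_iff]
    constructor
    · rintro ⟨h1, hw⟩
      rw [hS x u w hx hu hw hxu] at h1
      exact ⟨⟨hw, h1.2⟩, h1.1.symm⟩
    · rintro ⟨⟨hw, h1⟩, hne⟩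
      exact ⟨(hS x u w hx hu hw hxu).2 ⟨Ne.symm hne, h1⟩, hw⟩
  · obtain ⟨x, hx⟩ := X.verts_nonempty
    obtain ⟨u, v, hu, hv, hne, hxu, hxv⟩ := hleaf x hx
    exact ⟨u, v, hu, hv, (hS x u v hx hu hv hxu).2 ⟨hne, hxv⟩⟩
  -- If `X` were a single vertex, equitability would make it adjacent to all of `Y` or to none.
  · obtain ⟨x, hx, x', hx', hne⟩ : ∃ x ∈ X.verts, ∃ x' ∈ X.verts, x ≠ x' := by
      by_contra! hsub
      rw [IsIsotropic, not_or, IsEmptyBetween, IsCompleteBetween] at haniso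
      push Not at haniso
      obtain ⟨⟨x, hx, y, hy, hxy⟩, x', hx', y', hy', hxy'⟩ := haniso
      obtain rfl := hsub x hx x' hx'
      have := ncard_adj_cell_eq (hy.trans hy'.symm) X
      have h0 : {w | G.Adj y' w ∧ cellOf G w = X} = ∅ := by
        ext w
        simp only [Set.mem_ofPred_eq, Set.mem_empty_iff_false, iff_false, not_and]
        intro hw hwX
        exact hxy' (hsub w hwX x hx ▸ hw.symm)
      rw [h0, Set.ncard_empty, Set.ncard_eq_zero] at this
      exact (this.subset ⟨hxy.symm, hx⟩ : x ∈ (∅ : Set V))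
    obtain ⟨u, -, hu, -, -, hxu, -⟩ := hleaf x hx
    obtain ⟨v, -, hv, -, -, hxv, -⟩ := hleaf x' hx'
    obtain ⟨c, -, hc⟩ := hcenter v hv
    have hnot : ¬ adj x v := fun h => hne ((hc x ⟨hx, h⟩).trans (hc x' ⟨hx', hxv⟩).symm)
    exact ⟨u, v, hu, hv, fun h => hnot (h ▸ hxu), fun h => hnot ((hS x u v hx hu hv hxu).1 h).2⟩

lemma hasInvariantGraph_of_not_isHomogeneous [Finite V] {X : Cell G} (h : ¬ IsHomogeneous G X) :
    HasInvariantGraph {s(X, X)} X := by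
  rw [IsHomogeneous, not_or, IsEmptyOn, IsCompleteOn] at h
  push Not at h
  obtain ⟨⟨u, hu, v, hv, huv⟩, u', hu', v', hv', hne, huv'⟩ := h
  exact ⟨G, fun φ hφ a b ha hb => hφ.2 a b (by rw [ha, hb]; rfl),
    fun a b ha hb => ncard_adj_cell_eq (ha.trans hb.symm) X,
    ⟨u, v, hu, hv, huv⟩, u', v', hu', hv', hne, huv'⟩

end Stars

/-! ### The anisotropic component is a tree -/

section Tree

variable {V : Type u} {G : SimpleGraph V} {A : AnisotropicComponent G} {R : Cell G}

lemma mem_supp_of_adj {X Y : Cell G} (h : (anisotropicGraph G).Adj X Y) (hY : Y ∈ A.supp) :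
    X ∈ A.supp := by
  rw [SimpleGraph.ConnectedComponent.mem_supp_iff] at hY ⊢
  rw [← hY]
  exact SimpleGraph.ConnectedComponent.connectedComponentMk_eq_of_adj h

lemma exists_isChildCell (hR : R ∈ A.supp) {Y : Cell G} (hY : Y ∈ A.supp) (hYR : Y ≠ R) :
    ∃ X, IsChildCell R X Y := by
  have hreach : (anisotropicGraph G).Reachable Y R := A.reachable_of_mem_supp hY hR
  obtain ⟨w, hw⟩ := hreach.exists_walk_length_eq_dist
  cases w with
  | nil => exact (hYR rfl).elim
  | cons h q =>
    rename_i X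
    refine ⟨X, h.symm, le_antisymm ?_ ?_⟩
    · rw [SimpleGraph.dist_comm, ← hw, SimpleGraph.Walk.length_cons, SimpleGraph.dist_comm,
        add_le_add_iff_right]
      by_contra! hlt
      obtain ⟨w', hw'⟩ := q.reachable.exists_walk_length_eq_dist
      have := SimpleGraph.dist_le (SimpleGraph.Walk.cons h w')
      rw [← hw, SimpleGraph.Walk.length_cons, SimpleGraph.Walk.length_cons, hw'] at this
      omega
    · rw [SimpleGraph.dist_comm, SimpleGraph.dist_comm (v := Y), ← hw, SimpleGraph.Walk.length_cons,
        add_le_add_iff_right]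
      exact SimpleGraph.dist_le q

/-- An anisotropic component of an amenable graph is a tree on which cardinalities do not decrease
away from the root, and all whose cells but the root are homogeneous. The tree is described by the
function that maps a cell to its parent. -/
theorem IsAmenable.exists_parentCell [Finite V] (hG : IsAmenable G) (hR : IsRoot A R) :
    ∃ p : Cell G → Cell G,
      (∀ Y ∈ A.supp, Y ≠ R → IsChildCell R (p Y) Y ∧ (p Y).size ≤ Y.size ∧ IsHomogeneous G Y) ∧
      ∀ P ∈ A.supp, ∀ Q ∈ A.supp, (anisotropicGraph G).Adj P Q →
        (Q ≠ R ∧ P = p Q) ∨ (P ≠ R ∧ Q = p P) := by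
  classical
  obtain ⟨hRA, hRhet, hRmin⟩ := hR
  have hex : ∀ Y, ∃ X, Y ∈ A.supp → Y ≠ R → IsChildCell R X Y := by
    intro Y
    by_cases h : Y ∈ A.supp ∧ Y ≠ R
    · obtain ⟨X, hX⟩ := exists_isChildCell hRA h.1 h.2
      exact ⟨X, fun _ _ => hX⟩
    · exact ⟨Y, fun h1 h2 => (h ⟨h1, h2⟩).elim⟩
  choose p hp using hex
  have hpA : ∀ Y ∈ A.supp, Y ≠ R → p Y ∈ A.supp := fun Y hY hYR =>
    mem_supp_of_adj (hp Y hY hYR).1 hY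
  have hpne : ∀ Y ∈ A.supp, Y ≠ R → p Y ≠ Y := fun Y hY hYR => (hp Y hY hYR).1.1
  have hne_of_size : ∀ {a b c d : Cell G}, a.size = b.size → c.size < d.size →
      s(a, b) ≠ s(c, d) := by
    intro a b c d h1 h2 h
    rcases Sym2.eq_iff.1 h with ⟨rfl, rfl⟩ | ⟨rfl, rfl⟩ <;> omega
  -- The parent edges between cells of equal size: along them structure is carried over by
  -- bijections.
  set TE : Set (Sym2 (Cell G)) :=
    {e | ∃ Y ∈ A.supp, Y ≠ R ∧ (p Y).size = Y.size ∧ e = s(p Y, Y)} with hTE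
  -- A source of `Y` is a cell linked to `Y` through `TE`, of the same size, at which structure
  -- originates: it is the root, or it is larger than its parent.
  set Src : Cell G → Cell G → Prop := fun Y₀ Y => Y₀ ∈ A.supp ∧ Y₀.size = Y.size ∧ Linked TE Y₀ Y ∧
    (Y₀ ≠ R → (p Y₀).size < Y₀.size) with hSrc
  have hdiag : ∀ Y, s(Y, Y) ∉ TE := by
    rintro Y ⟨Z, hZ, hZR, -, h⟩
    rcases Sym2.eq_iff.1 h with ⟨h1, h2⟩ | ⟨h1, h2⟩
    · exact hpne Z hZ hZR (h1.symm.trans h2)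
    · exact hpne Z hZ hZR (h2.symm.trans h1)
  have hltTE : ∀ {c d : Cell G}, c.size < d.size → s(c, d) ∉ TE := by
    rintro c d h ⟨Z, hZ, hZR, hs, he⟩
    exact hne_of_size hs h he.symm
  have hsub : ∀ {E : Set (Sym2 (Cell G))} {e}, e ∉ E → E ⊆ {e}ᶜ := by
    rintro E e he f hf rfl
    exact he hf
  -- The source passes to `Y` the graph coming from its strictly smaller parent, or from its own
  -- edges if it is a heterogeneous root, without using `e`. A homogeneous root offers no such
  -- graph, but then `Y` has the least cardinality in `A`.
  have hK : ∀ Y₀ Y e, Src Y₀ Y → e ∉ TE → e ≠ s(R, R) → (Y₀ ≠ R → e ≠ s(p Y₀, Y₀)) →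
      HasInvariantGraph {e}ᶜ Y ∨ ∀ X ∈ A.supp, Y.size ≤ X.size := by
    rintro Y₀ Y e ⟨hY₀, hs, hL, hlt⟩ he h1 h2
    have hL' := hL.mono (hsub he)
    by_cases hY₀R : Y₀ = R
    · subst hY₀R
      by_cases hhom : IsHomogeneous G Y₀
      · right
        rw [← hs]
        refine hRmin ?_
        by_contra! hcon
        exact hRhet hcon hhom
      · left
        refine ((hasInvariantGraph_of_not_isHomogeneous hhom).mono ?_).of_linked hL'
        exact hsub h1
    · left
      refine ((hG.hasInvariantGraph_of_size_lt (hp Y₀ hY₀ hY₀R).1.2 (hlt hY₀R)).mono ?_).of_linked hL'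
      exact hsub (h2 hY₀R)
  -- A child smaller than its parent would put a second invariant graph on the parent, besides the
  -- one passed on by the source.
  have hmono : ∀ Y ∈ A.supp, Y ≠ R → ∀ X₀, Src X₀ (p Y) → (p Y).size ≤ Y.size := by
    intro Y hY hYR X₀ hX₀
    by_contra! hlt
    have hadj := (hp Y hY hYR).1.symm
    rcases hK X₀ (p Y) s(Y, p Y) hX₀ (hltTE hlt) (fun h => hadj.1 (by
        rcases Sym2.eq_iff.1 h with ⟨h1, h2⟩ | ⟨h1, h2⟩ <;> exact h1.trans h2.symm)) (fun hR h => by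
        have hs := hX₀.2.2.2 hR
        rcases Sym2.eq_iff.1 h with ⟨h1, h2⟩ | ⟨h1, h2⟩
        · have e1 := (hp X₀ hX₀.1 hR).2
          have e2 := (hp Y hY hYR).2
          rw [← h1] at e1
          rw [h2] at e2
          omega
        · have := hX₀.2.1
          rw [h2] at this
          omega) with h | h
    · exact hG.not_hasInvariantGraph (hG.hasInvariantGraph_of_size_lt hadj.2 hlt) h
    · exact absurd (h Y hY) (by omega)
  have hsrc : ∀ n, ∀ Y ∈ A.supp, (anisotropicGraph G).dist R Y = n → ∃ Y₀, Src Y₀ Y := by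
    intro n
    induction n with
    | zero =>
      intro Y hY hd
      have hreach : (anisotropicGraph G).Reachable R Y := A.reachable_of_mem_supp hRA hY
      obtain rfl := hreach.dist_eq_zero_iff.1 hd
      exact ⟨R, hRA, rfl, Linked.refl _ _, fun h => (h rfl).elim⟩
    | succ n ih =>
      intro Y hY hd
      have hYR : Y ≠ R := by
        rintro rfl
        simp at hd
      have hd' := (hp Y hY hYR).2
      obtain ⟨X₀, hX₀⟩ := ih (p Y) (hpA Y hY hYR) (by omega)
      rcases (hmono Y hY hYR X₀ hX₀).lt_or_eq with h | h
      · exact ⟨Y, hY, rfl, Linked.refl _ _, fun _ => h⟩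
      · refine ⟨X₀, hX₀.1, hX₀.2.1.trans h, hX₀.2.2.1.trans
          ((hG.linked_of_size_eq (hpne Y hY hYR) (hp Y hY hYR).1.2 h).mono ?_), hX₀.2.2.2⟩
        rintro _ rfl
        exact ⟨Y, hY, hYR, h, rfl⟩
  replace hsrc : ∀ Y ∈ A.supp, ∃ Y₀, Src Y₀ Y := fun Y hY => hsrc _ Y hY rfl
  refine ⟨p, fun Y hY hYR => ⟨hp Y hY hYR, ?_, ?_⟩, ?_⟩
  · obtain ⟨X₀, hX₀⟩ := hsrc (p Y) (hpA Y hY hYR)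
    exact hmono Y hY hYR X₀ hX₀
  · by_contra hhom
    obtain ⟨Y₀, hY₀⟩ := hsrc Y hY
    have hRhom := hRhet ⟨Y, hY, hhom⟩
    -- By the choice of the root, `R` is heterogeneous too. Every source thus yields a graph on `Y`
    -- that does not depend on `G[Y]`.
    have hinv : HasInvariantGraph {s(Y, Y)}ᶜ Y := by
      by_cases hY₀R : Y₀ = R
      · rw [hY₀R] at hY₀
        refine ((hasInvariantGraph_of_not_isHomogeneous hRhom).mono (hsub ?_)).of_linked
          (hY₀.2.2.1.mono (hsub (hdiag Y)))
        simpa using hYR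
      · refine ((hG.hasInvariantGraph_of_size_lt (hp Y₀ hY₀.1 hY₀R).1.2 (hY₀.2.2.2 hY₀R)).mono
          (hsub ?_)).of_linked (hY₀.2.2.1.mono (hsub (hdiag Y)))
        exact hne_of_size rfl (hY₀.2.2.2 hY₀R)
    exact hG.not_hasInvariantGraph (hasInvariantGraph_of_not_isHomogeneous hhom) hinv
  -- If the equal-sized neighbors `P` and `Q` have distinct sources, the graph that `Q₀` gets from
  -- its parent would meet the structure arriving from `P₀` through the matching of `P` and `Q`.
  -- Hence `Q₀` is the root, and exchanging the roles gives the same for `P₀`.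
  · have hconf : ∀ P Q P₀ Q₀, (anisotropicGraph G).Adj P Q → P.size = Q.size → Src P₀ P →
        Src Q₀ Q → P₀ ≠ Q₀ → Q₀ = R := by
      intro P Q P₀ Q₀ hadj hs hP hQ hne
      by_contra hQR
      have hlt := hQ.2.2.2 hQR
      rcases hK P₀ P s(p Q₀, Q₀) hP (hltTE hlt) (hne_of_size rfl hlt).symm (fun hPR h => by
          have h1 := hP.2.2.2 hPR
          have h2 := hP.2.1
          have h3 := hQ.2.1
          rcases Sym2.eq_iff.1 h with ⟨-, h4⟩ | ⟨h4, -⟩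
          · exact hne h4.symm
          · rw [h4] at hlt
            omega) with h | h
      · refine hG.not_hasInvariantGraph (hG.hasInvariantGraph_of_size_lt (hp Q₀ hQ.1 hQR).1.2 hlt) ?_
        refine h.of_linked (((hG.linked_of_size_eq hadj.1 hadj.2 hs).mono (hsub ?_)).trans
          (hQ.2.2.1.mono (hsub (hltTE hlt))).symm)
        exact (hne_of_size hs hlt).symm
      · have := h _ (hpA Q₀ hQ.1 hQR)
        have := hQ.2.1
        omega
    have hmain : ∀ P ∈ A.supp, ∀ Q ∈ A.supp, (anisotropicGraph G).Adj P Q → P.size ≤ Q.size →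
        (Q ≠ R ∧ P = p Q) ∨ (P ≠ R ∧ Q = p P) := by
      intro P hP Q hQ hadj hle
      by_contra! hcon
      have hT : ∀ Y ∈ A.supp, Y ≠ R → s(P, Q) ≠ s(p Y, Y) := by
        intro Y hY hYR h
        rcases Sym2.eq_iff.1 h with ⟨h1, rfl⟩ | ⟨rfl, h1⟩
        · exact hcon.1 hYR h1
        · exact hcon.2 hYR h1
      have heTE : s(P, Q) ∉ TE := by
        rintro ⟨Y, hY, hYR, -, h⟩
        exact hT Y hY hYR h
      obtain ⟨P₀, hP₀⟩ := hsrc P hP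
      obtain ⟨Q₀, hQ₀⟩ := hsrc Q hQ
      rcases hle.lt_or_eq with hlt | heq
      · rcases hK Q₀ Q s(P, Q) hQ₀ heTE (hne_of_size rfl hlt).symm
          (fun h => hT Q₀ hQ₀.1 h) with h | h
        · exact hG.not_hasInvariantGraph (hG.hasInvariantGraph_of_size_lt hadj.2 hlt) h
        · exact absurd (h P hP) (by omega)
      -- For a non-tree edge between cells of equal size, a common source links `P` and `Q` without
      -- using the edge, and distinct sources would both be the root.
      · by_cases hPQ : P₀ = Q₀
        · subst hPQ
          exact hG.not_linked hadj.1 hadj.2 ((hP₀.2.2.1.symm.trans hQ₀.2.2.1).mono (hsub heTE))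
        · have h1 := hconf P Q P₀ Q₀ hadj heq hP₀ hQ₀ hPQ
          have h2 := hconf Q P Q₀ P₀ hadj.symm heq.symm hQ₀ hP₀ (Ne.symm hPQ)
          exact hPQ (h2.trans h1.symm)
    intro P hP Q hQ hadj
    rcases le_total P.size Q.size with h | h
    · exact hmain P hP Q hQ hadj h
    · exact (hmain Q hQ P hP hadj.symm h).symm

end Tree

/-! ### Least cardinalities -/

section MinCard

variable {α β : Type*}

/-- The least cardinality of a finite set with property `P`. -/
noncomputable def minCard (P : Finset α → Prop) : ℕ := sInf {n | ∃ S : Finset α, P S ∧ S.card = n}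

lemma minCard_le {P : Finset α → Prop} {S : Finset α} (h : P S) : minCard P ≤ S.card :=
  Nat.sInf_le ⟨S, h, rfl⟩

lemma exists_card_eq_minCard {P : Finset α → Prop} (h : ∃ S, P S) :
    ∃ S, P S ∧ S.card = minCard P := by
  obtain ⟨S, hS⟩ := h
  exact Nat.sInf_mem (s := {n | ∃ S : Finset α, P S ∧ S.card = n}) ⟨_, S, hS, rfl⟩

/-- Some set with property `Q` must exist, since `sInf ∅ = 0`. -/
lemma minCard_le_minCard {P : Finset α → Prop} {Q : Finset β → Prop} (hQ : ∃ S, Q S)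
    (h : ∀ S, Q S → ∃ T, P T ∧ T.card ≤ S.card) : minCard P ≤ minCard Q := by
  obtain ⟨S, hS, hcard⟩ := exists_card_eq_minCard hQ
  obtain ⟨T, hT, hle⟩ := h S hS
  rw [← hcard]
  exact (minCard_le hT).trans hle

end MinCard

/-! ### Automorphisms of a graph with rooted trees attached to one cell -/

section Jellyfish

variable {W C : Type*}

/-- The vertices from which `x` can be reached by repeatedly passing to the parent `par y` of a
vertex `y` outside of the cell `R`. -/
def below (κ : W → C) (R : C) (par : W → W) (x : W) : Set W :=
  {y | Relation.ReflTransGen (fun x y => κ y ≠ R ∧ par y = x) x y}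

/-- `J` consists of a graph on the cell `R` and of rooted trees attached to the vertices of this
cell, where `par` maps every other vertex to its parent. The cells are the fibers of `κ`, and the
number of children in a given cell depends only on the cell of a vertex. -/
structure IsJellyfish (J : SimpleGraph W) (κ : W → C) (R : C) (par : W → W) (d : C → ℕ) : Prop where
  depth_lt : ∀ w, κ w ≠ R → d (κ (par w)) < d (κ w)
  cell_par : ∀ w w', κ w ≠ R → κ w = κ w' → κ (par w) = κ (par w')
  ncard_children : ∀ Y, Y ≠ R → ∀ x x', κ x = κ x' →
    {y | κ y = Y ∧ par y = x}.ncard = {y | κ y = Y ∧ par y = x'}.ncard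
  adj_iff : ∀ u v, ¬ (κ u = R ∧ κ v = R) →
    (J.Adj u v ↔ (κ v ≠ R ∧ par v = u) ∨ (κ u ≠ R ∧ par u = v))

variable {J : SimpleGraph W} {κ : W → C} {R : C} {par : W → W} {d : C → ℕ}

lemma mem_below_self (x : W) : x ∈ below κ R par x := Relation.ReflTransGen.refl

lemma mem_below_iff {x y : W} :
    y ∈ below κ R par x ↔ y = x ∨ (κ y ≠ R ∧ par y ∈ below κ R par x) := by
  constructor
  · intro h
    rcases Relation.ReflTransGen.cases_tail h with h | ⟨c, hc, hcy⟩
    · exact Or.inl h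
    · rw [← hcy.2] at hc
      exact Or.inr ⟨hcy.1, hc⟩
  · rintro (rfl | ⟨h1, h2⟩)
    · exact mem_below_self y
    · exact Relation.ReflTransGen.tail h2 ⟨h1, rfl⟩

lemma below_subset {x y : W} (h : y ∈ below κ R par x) : below κ R par y ⊆ below κ R par x :=
  fun _ hz => Relation.ReflTransGen.trans h hz

lemma mem_below_of_par_mem {x y : W} (h : κ y ≠ R) (hy : par y ∈ below κ R par x) :
    y ∈ below κ R par x := mem_below_iff.2 (Or.inr ⟨h, hy⟩)

namespace IsJellyfish

variable (hJ : IsJellyfish J κ R par d)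
include hJ

lemma depth_induction {P : W → Prop} (h : ∀ w, (κ w ≠ R → P (par w)) → P w) (w : W) : P w := by
  induction hn : d (κ w) using Nat.strong_induction_on generalizing w with
  | _ n ih =>
    subst hn
    exact h w fun hw => ih _ (hJ.depth_lt w hw) _ rfl

lemma depth_le {x y : W} (h : y ∈ below κ R par x) : d (κ x) ≤ d (κ y) := by
  induction h with
  | refl => exact le_rfl
  | tail _ h ih =>
    obtain ⟨h1, rfl⟩ := h
    exact ih.trans (hJ.depth_lt _ h1).le

lemma eq_of_mem_below {x y : W} (h : y ∈ below κ R par x) (hκ : d (κ y) ≤ d (κ x)) : y = x := by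
  rcases mem_below_iff.1 h with h | ⟨h1, h2⟩
  · exact h
  · have := hJ.depth_le h2
    have := hJ.depth_lt y h1
    omega

/-- Two vertices of one cell have the same depth, so a common descendant has only one ancestor
there: trees below distinct vertices of a cell are disjoint. -/
lemma eq_of_mem_below_of_mem_below {x y z : W} (hxy : κ x = κ y) (hx : z ∈ below κ R par x)
    (hy : z ∈ below κ R par y) : x = y := by
  induction z using hJ.depth_induction with
  | h z ih =>
    rcases mem_below_iff.1 hx with h | ⟨h1, h2⟩
    · rw [h] at hy
      exact hJ.eq_of_mem_below hy (by rw [hxy])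
    · rcases mem_below_iff.1 hy with k | ⟨_, k2⟩
      · rw [k] at hx
        exact (hJ.eq_of_mem_below hx (by rw [hxy])).symm
      · exact ih h1 h2 k2

lemma exists_root (w : W) : ∃ v, κ v = R ∧ w ∈ below κ R par v := by
  induction w using hJ.depth_induction with
  | h w ih =>
    by_cases hw : κ w = R
    · exact ⟨w, hw, mem_below_self w⟩
    · obtain ⟨v, hv, h⟩ := ih hw
      exact ⟨v, hv, mem_below_of_par_mem hw h⟩

/-- `g x w` moves `w` to a child of `x` in the same cell, by a bijection chosen for each pair of
parents in one cell and each child cell. It is the identity when `x` is already the parent of `w`,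
so that extensions move nothing unnecessarily. -/
lemma exists_transport [Finite W] : ∃ g : W → W → W, (∀ w, g (par w) w = w) ∧
    ∀ x w, κ w ≠ R → κ x = κ (par w) → κ (g x w) = κ w ∧ par (g x w) = x ∧
      ∀ w', κ w' = κ w → par w' = par w → g x w = g x w' → w = w' := by
  classical
  have he : ∀ x x' c, κ x = κ x' → c ≠ R →
      Nonempty ({y | κ y = c ∧ par y = x} ≃ {y | κ y = c ∧ par y = x'}) := fun x x' c hx hc =>
    Finite.card_eq.1 (by
      rw [Nat.card_coe_set_eq, Nat.card_coe_set_eq]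
      exact hJ.ncard_children c hc x x' hx)
  let g : W → W → W := fun x w =>
    if x = par w then w
    else if h : κ (par w) = κ x ∧ κ w ≠ R then (he (par w) x (κ w) h.1 h.2).some ⟨w, rfl, rfl⟩
    else w
  refine ⟨g, fun w => if_pos rfl, fun x w hw hx => ?_⟩
  by_cases hxw : x = par w
  · have hg : ∀ w', par w' = par w → g x w' = w' := fun w' h => if_pos (hxw.trans h.symm)
    refine ⟨by rw [hg w rfl], by rw [hg w rfl, hxw], fun w' _ h => ?_⟩
    rw [hg w rfl, hg w' h]
    exact id
  · have hg : g x w = (he (par w) x (κ w) hx.symm hw).some ⟨w, rfl, rfl⟩ := by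
      simp only [g, if_neg hxw]
      exact dif_pos ⟨hx.symm, hw⟩
    refine ⟨?_, ?_, fun w' h1 h2 h => ?_⟩
    · rw [hg]
      exact ((he (par w) x (κ w) hx.symm hw).some ⟨w, rfl, rfl⟩).2.1
    · rw [hg]
      exact ((he (par w) x (κ w) hx.symm hw).some ⟨w, rfl, rfl⟩).2.2
    -- The chosen bijection depends only on the parent and the cell, so the siblings `w` and `w'`
    -- are moved by the same one. Both are made variables to allow the substitution.
    · have key : ∀ (q : W) (c : C) (hq : κ q = κ x) (hc : c ≠ R) (h1 : κ w' = c)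
          (h2 : par w' = q), g x w' = (he q x c hq hc).some ⟨w', h1, h2⟩ := by
        rintro q c hq hc rfl rfl
        simp only [g]
        rw [if_neg (by rwa [h2]), dif_pos ⟨hq, hc⟩]
      rw [hg, key _ _ hx.symm hw h1 h2] at h
      exact congrArg Subtype.val ((he (par w) x (κ w) hx.symm hw).some.injective (Subtype.ext h))

/-- A permutation of one cell that preserves parents extends to a permutation that preserves cells
and parents, and fixes every vertex whose ancestor in the given cell is fixed. -/
lemma exists_extension [Finite W] (Y : C) (σ : Equiv.Perm W) (hκ : ∀ w, κ (σ w) = κ w)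
    (hpar : ∀ w, κ w = Y → κ w ≠ R → par (σ w) = par w) :
    ∃ π : Equiv.Perm W, (∀ w, κ (π w) = κ w) ∧ (∀ w, κ w = Y → π w = σ w) ∧
      (∀ w, κ w ≠ R → par (π w) = π (par w)) ∧
      ∀ w, (∀ z, κ z = Y → w ∈ below κ R par z → σ z = z) → π w = w := by
  classical
  obtain ⟨g, g1, g2⟩ := hJ.exists_transport
  -- The map is built from the top down by recursion on the depth: `σ` on `Y`, the identity on a
  -- root cell other than `Y`, and elsewhere transport to the image of the parent.
  obtain ⟨f, hf⟩ : ∃ f : W → W, ∀ w, f w =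
      if κ w = Y then σ w else if κ w = R then w else g (f (par w)) w := by
    let F : ∀ w, (∀ y, d (κ y) < d (κ w) → W) → W := fun w ih =>
      if κ w = Y then σ w else if h : κ w = R then w else g (ih (par w) (hJ.depth_lt w h)) w
    refine ⟨(measure fun w => d (κ w)).wf.fix F, fun w => ?_⟩
    rw [WellFounded.fix_eq]
    rfl
  have fY : ∀ w, κ w = Y → f w = σ w := fun w hw => by rw [hf, if_pos hw]
  have fR : ∀ w, κ w ≠ Y → κ w = R → f w = w := fun w h1 h2 => by rw [hf, if_neg h1, if_pos h2]
  have fg : ∀ w, κ w ≠ Y → κ w ≠ R → f w = g (f (par w)) w := fun w h1 h2 => by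
    rw [hf, if_neg h1, if_neg h2]
  have fκ : ∀ w, κ (f w) = κ w := by
    refine hJ.depth_induction fun w ih => ?_
    by_cases h1 : κ w = Y
    · rw [fY w h1, hκ]
    by_cases h2 : κ w = R
    · rw [fR w h1 h2]
    rw [fg w h1 h2]
    exact (g2 _ w h2 (ih h2)).1
  have ffix : ∀ w, (∀ z, κ z = Y → w ∈ below κ R par z → σ z = z) → f w = w := by
    refine hJ.depth_induction fun w ih hw => ?_
    by_cases h1 : κ w = Y
    · rw [fY w h1, hw w h1 (mem_below_self w)]
    by_cases h2 : κ w = R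
    · rw [fR w h1 h2]
    rw [fg w h1 h2, ih h2 fun z hz hzw => hw z hz (mem_below_of_par_mem h2 hzw), g1]
  have fpar : ∀ w, κ w ≠ R → par (f w) = f (par w) := by
    intro w hw
    by_cases h1 : κ w = Y
    -- The parent of a vertex of `Y` is less deep than `Y`, hence not below any vertex of `Y`, and
    -- is fixed.
    · rw [fY w h1, hpar w h1 hw, ffix]
      intro z hz hzw
      have := hJ.depth_le hzw
      have := hJ.depth_lt w hw
      rw [h1] at this
      rw [hz] at *
      omega
    · rw [fg w h1 hw]
      exact (g2 _ w hw (fκ _)).2.1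
  have finj : ∀ w w', f w = f w' → w = w' := by
    refine hJ.depth_induction fun w ih w' h => ?_
    have hκw : κ w' = κ w := by rw [← fκ w, h, fκ]
    by_cases h1 : κ w = Y
    · rw [fY w h1, fY w' (hκw.trans h1)] at h
      exact σ.injective h
    by_cases h2 : κ w = R
    · rwa [fR w h1 h2, fR w' (by rwa [hκw]) (by rwa [hκw])] at h
    have hp : par w' = par w := by
      refine (ih h2 _ ?_).symm
      rw [← fpar w h2, h, fpar w' (by rwa [hκw])]
    rw [fg w h1 h2, fg w' (by rwa [hκw]) (by rwa [hκw]), hp] at h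
    exact (g2 _ w h2 (fκ _)).2.2 w' hκw hp h
  exact ⟨Equiv.ofBijective f (Finite.injective_iff_bijective.1 finj), fκ, fY, fpar, ffix⟩

/-- Permutations that preserve cells, parents, and the graph on the root cell are automorphisms. -/
lemma adj_iff_of_par {π : Equiv.Perm W} (hκ : ∀ w, κ (π w) = κ w)
    (hpar : ∀ w, κ w ≠ R → par (π w) = π (par w))
    (hR : ∀ u v, κ u = R → κ v = R → (J.Adj (π u) (π v) ↔ J.Adj u v)) (u v : W) :
    J.Adj (π u) (π v) ↔ J.Adj u v := by
  by_cases h : κ u = R ∧ κ v = R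
  · exact hR u v h.1 h.2
  · rw [hJ.adj_iff _ _ h, hJ.adj_iff _ _ (by rwa [hκ, hκ]), hκ, hκ]
    refine or_congr (and_congr_right fun hv => ?_) (and_congr_right fun hu => ?_)
    · rw [hpar v hv, π.injective.eq_iff]
    · rw [hpar u hu, π.injective.eq_iff]

/-- For siblings `y`, `y'` in the same cell there is an automorphism that exchanges the trees below
them and fixes all other vertices. -/
lemma exists_swap [Finite W] {y y' : W} (hκ : κ y = κ y') (hy : κ y ≠ R) (hpar : par y = par y') :
    ∃ π : Equiv.Perm W, (∀ w, κ (π w) = κ w) ∧ (∀ u v, J.Adj (π u) (π v) ↔ J.Adj u v) ∧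
      π y = y' ∧ ∀ w, w ∉ below κ R par y → w ∉ below κ R par y' → π w = w := by
  classical
  obtain ⟨π, p1, p2, p3, p4⟩ := hJ.exists_extension (κ y) (Equiv.swap y y')
    (fun w => by
      rcases eq_or_ne w y with rfl | h1
      · rw [Equiv.swap_apply_left, hκ]
      rcases eq_or_ne w y' with rfl | h2
      · rw [Equiv.swap_apply_right, hκ]
      rw [Equiv.swap_apply_of_ne_of_ne h1 h2])
    (fun w _ _ => by
      rcases eq_or_ne w y with rfl | h1
      · rw [Equiv.swap_apply_left, hpar]
      rcases eq_or_ne w y' with rfl | h2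
      · rw [Equiv.swap_apply_right, hpar]
      rw [Equiv.swap_apply_of_ne_of_ne h1 h2])
  have hfix : ∀ w, w ∉ below κ R par y → w ∉ below κ R par y' → π w = w := by
    intro w h1 h2
    refine p4 w fun z _ hz => Equiv.swap_apply_of_ne_of_ne ?_ ?_
    · rintro rfl; exact h1 hz
    · rintro rfl; exact h2 hz
  have hroot : ∀ w, κ w = R → π w = w := by
    intro w hw
    refine p4 w fun z hz hzw => ?_
    rcases mem_below_iff.1 hzw with rfl | ⟨h, _⟩
    · exact (hy (hz.symm.trans hw)).elim
    · exact (h hw).elim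
  refine ⟨π, p1, hJ.adj_iff_of_par p1 p3 fun u v hu hv => by rw [hroot u hu, hroot v hv], ?_, hfix⟩
  rw [p2 y rfl, Equiv.swap_apply_left]

end IsJellyfish

end Jellyfish

/-! ### Fixing sets as sets that meet sibling trees -/

section FixingOn

variable {W C : Type*}

/-- `ρ` restricts to a cell-preserving automorphism of the subgraph of `J` induced by `D`. -/
structure IsAutOn (J : SimpleGraph W) (κ : W → C) (D : Set W) (ρ : Equiv.Perm W) : Prop where
  cell : ∀ w, κ (ρ w) = κ w
  mem_iff : ∀ w, ρ w ∈ D ↔ w ∈ D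
  adj_iff : ∀ u ∈ D, ∀ v ∈ D, (J.Adj (ρ u) (ρ v) ↔ J.Adj u v)

/-- The identity is the only cell-preserving automorphism of `J[D]` that fixes the elements of `S`. -/
def IsFixingOn (J : SimpleGraph W) (κ : W → C) (D : Set W) (S : Finset W) : Prop :=
  ∀ ρ, IsAutOn J κ D ρ → (∀ s ∈ S, s ∈ D → ρ s = s) → ∀ w ∈ D, ρ w = w

/-- `S` meets the union of the trees below any two siblings of the same cell whose parent is in
`D`. -/
def HitsSiblings (κ : W → C) (R : C) (par : W → W) (D : Set W) (S : Finset W) : Prop :=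
  ∀ y y', y ≠ y' → κ y = κ y' → κ y ≠ R → par y = par y' → par y ∈ D →
    ∃ s ∈ S, s ∈ below κ R par y ∨ s ∈ below κ R par y'

variable {J : SimpleGraph W} {κ : W → C} {R : C} {par : W → W} {d : C → ℕ} {D : Set W}

lemma IsAutOn.symm {ρ : Equiv.Perm W} (h : IsAutOn J κ D ρ) : IsAutOn J κ D ρ.symm where
  cell w := by rw [← h.cell, ρ.apply_symm_apply]
  mem_iff w := by rw [← h.mem_iff, ρ.apply_symm_apply]
  adj_iff u hu v hv := by
    rw [← h.adj_iff _ (by rwa [← h.mem_iff, ρ.apply_symm_apply]) _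
      (by rwa [← h.mem_iff, ρ.apply_symm_apply]), ρ.apply_symm_apply, ρ.apply_symm_apply]

lemma isFixingOn_univ [Fintype W] : IsFixingOn J κ D Finset.univ :=
  fun _ _ h w hw => h w (Finset.mem_univ w) hw

lemma isCellFixingSet_iff_isFixingOn_univ {S : Finset W} :
    IsCellFixingSet J κ S ↔ IsFixingOn J κ Set.univ S := by
  constructor
  · intro h ρ hρ hS w _
    exact h ⟨ρ, hρ.adj_iff _ trivial _ trivial⟩ hρ.cell (fun s hs => hS s hs trivial) w
  · intro h π hπ hS w
    exact h π.toEquiv ⟨hπ, fun _ => by simp, fun u _ v _ => π.map_rel_iff⟩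
      (fun s hs _ => hS s hs) w trivial

lemma cellFixingNumber_eq_minCard_univ (J : SimpleGraph W) (κ : W → C) :
    cellFixingNumber J κ = minCard (IsFixingOn J κ Set.univ) := by
  unfold cellFixingNumber minCard
  simp_rw [isCellFixingSet_iff_isFixingOn_univ]

/-- Automorphisms of `J[D]` extend by the identity to permutations of `W`. This allows all later
arguments to work with subsets of `W` instead of subtypes. -/
lemma cellFixingNumber_induce_eq_minCard [Finite W] (J : SimpleGraph W) (κ : W → C) (D : Set W) :
    cellFixingNumber (J.induce D) (fun v => κ v.1) = minCard (IsFixingOn J κ D) := by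
  classical
  have := Fintype.ofFinite W
  refine le_antisymm (minCard_le_minCard (P := IsCellFixingSet (J.induce D) fun v => κ v.1)
    ⟨_, isFixingOn_univ⟩ fun S hS => ?_)
    (minCard_le_minCard (Q := IsCellFixingSet (J.induce D) fun v => κ v.1)
      ⟨Finset.univ, fun _ _ h w => h w (Finset.mem_univ w)⟩ fun S hS => ?_)
  · refine ⟨S.subtype (· ∈ D), fun π hπ hfix w => ?_, ?_⟩
    · have := hS (Equiv.Perm.ofSubtype π.toEquiv) ⟨fun v => ?_, fun v => ?_, fun u hu v hv => ?_⟩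
        (fun s hs hsD => ?_) w w.2
      · rw [Equiv.Perm.ofSubtype_apply_coe] at this
        exact Subtype.ext this
      · by_cases hv : v ∈ D
        · rw [Equiv.Perm.ofSubtype_apply_of_mem _ hv]
          exact hπ ⟨v, hv⟩
        · rw [Equiv.Perm.ofSubtype_apply_of_not_mem _ hv]
      · exact Equiv.Perm.ofSubtype_apply_mem_iff_mem _ _
      · rw [Equiv.Perm.ofSubtype_apply_of_mem _ hu, Equiv.Perm.ofSubtype_apply_of_mem _ hv]
        exact π.map_rel_iff (a := ⟨u, hu⟩) (b := ⟨v, hv⟩)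
      · rw [Equiv.Perm.ofSubtype_apply_of_mem _ hsD]
        exact congrArg Subtype.val (hfix ⟨s, hsD⟩ (Finset.mem_subtype.2 hs))
    · rw [Finset.card_subtype]
      exact Finset.card_filter_le _ _
  · refine ⟨S.map (Function.Embedding.subtype _), fun ρ hρ hfix w hw => ?_, (Finset.card_map _).le⟩
    have := hS ⟨ρ.subtypePerm hρ.mem_iff, fun {u v} => hρ.adj_iff u u.2 v v.2⟩
      (fun v => hρ.cell v) (fun s hs => Subtype.ext (hfix s (Finset.mem_map_of_mem _ hs) s.2))
      ⟨w, hw⟩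
    exact congrArg Subtype.val this

namespace IsJellyfish

variable (hJ : IsJellyfish J κ R par d)
include hJ

/-- An edge that is not inside the root cell joins a vertex to its parent, and preserved cells mean
preserved depths, which rules out the reversed orientation. -/
lemma par_apply_of_isAutOn {ρ : Equiv.Perm W} (hρ : IsAutOn J κ D ρ) {w : W} (hw : κ w ≠ R)
    (hwD : w ∈ D) (hparD : par w ∈ D) : par (ρ w) = ρ (par w) := by
  have hR : ∀ v, ¬ (κ v = R ∧ κ w = R) := fun v h => hw h.2
  have h1 : J.Adj (par w) w := (hJ.adj_iff _ _ (hR _)).2 (Or.inl ⟨hw, rfl⟩)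
  have h2 := (hρ.adj_iff _ hparD _ hwD).2 h1
  rw [hJ.adj_iff _ _ (by rw [hρ.cell, hρ.cell]; exact hR _), hρ.cell, hρ.cell] at h2
  rcases h2 with h2 | ⟨h3, h4⟩
  · exact h2.2
  · have e1 := hJ.depth_lt (ρ (par w)) (by rwa [hρ.cell])
    have e2 := hJ.depth_lt w hw
    rw [h4, hρ.cell, hρ.cell] at e1
    omega

lemma apply_mem_below (hD : ∀ w ∈ D, below κ R par w ⊆ D) {ρ : Equiv.Perm W}
    (hρ : IsAutOn J κ D ρ) {w s : W} (hw : w ∈ D) (hs : s ∈ below κ R par w) :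
    ρ s ∈ below κ R par (ρ w) := by
  induction s using hJ.depth_induction with
  | h s ih =>
    rcases mem_below_iff.1 hs with rfl | ⟨h1, h2⟩
    · exact mem_below_self _
    · refine mem_below_of_par_mem (by rwa [hρ.cell]) ?_
      rw [hJ.par_apply_of_isAutOn hρ h1 (hD w hw hs) (hD w hw h2)]
      exact ih h1 h2

/-- A set that fixes all tops and meets enough trees is a fixing set. -/
lemma isFixingOn_of_hitsSiblings (hD : ∀ w ∈ D, below κ R par w ⊆ D) {S : Finset W}
    (hS : HitsSiblings κ R par D S)
    (htop : ∀ ρ, IsAutOn J κ D ρ → (∀ s ∈ S, s ∈ D → ρ s = s) →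
      ∀ w ∈ D, (κ w ≠ R → par w ∉ D) → ρ w = w) : IsFixingOn J κ D S := by
  intro ρ hρ hfix w hw
  induction w using hJ.depth_induction with
  | h w ih =>
    by_cases ht : κ w ≠ R → par w ∉ D
    · exact htop ρ hρ hfix w hw ht
    push Not at ht
    obtain ⟨hwR, hpD⟩ := ht
    by_contra hne
    have hpar : par (ρ w) = par w := by
      rw [hJ.par_apply_of_isAutOn hρ hwR hw hpD, ih hwR hpD]
    have hρw : ρ w ∈ D := (hρ.mem_iff w).2 hw
    -- If `w` moves while its parent is fixed, `w` and its image are siblings. A fixed `s` below one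
    -- of them would be below both, though the two trees are disjoint.
    obtain ⟨s, hs, hs'⟩ := hS w (ρ w) (Ne.symm hne) (hρ.cell w).symm hwR hpar.symm hpD
    have hsD : s ∈ D := hs'.elim (fun h => hD _ hw h) (fun h => hD _ hρw h)
    have hs1 := hfix s hs hsD
    rcases hs' with h | h
    · have h' := hJ.apply_mem_below hD hρ hw h
      rw [hs1] at h'
      exact hne (hJ.eq_of_mem_below_of_mem_below (hρ.cell w) h' h)
    · have h' := hJ.apply_mem_below hD hρ.symm hρw h
      rw [ρ.symm_apply_apply, show ρ.symm s = s by rw [Equiv.symm_apply_eq, hs1]] at h'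
      exact hne (hJ.eq_of_mem_below_of_mem_below (hρ.cell w) h h')

/-- Otherwise the exchange of two unmet sibling trees is a nontrivial automorphism fixing `S`. -/
lemma hitsSiblings_of_isFixingOn [Finite W] (hD : ∀ w ∈ D, below κ R par w ⊆ D) {S : Finset W}
    (hS : IsFixingOn J κ D S) : HitsSiblings κ R par D S := by
  intro y y' hne hκ hy hpar hpD
  by_contra! hcon
  obtain ⟨π, p1, p2, p3, p4⟩ := hJ.exists_swap hκ hy hpar
  have hyD : below κ R par y ⊆ D := hD y (hD _ hpD (mem_below_of_par_mem hy (mem_below_self _)))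
  have hyD' : below κ R par y' ⊆ D :=
    hD y' (hD _ hpD (mem_below_of_par_mem (hκ ▸ hy) (hpar ▸ mem_below_self _)))
  have hout : ∀ w, w ∉ D → π w = w := fun w hw => p4 w (fun h => hw (hyD h)) fun h => hw (hyD' h)
  have hmem : ∀ w, π w ∈ D ↔ w ∈ D := by
    intro w
    constructor
    · intro h
      by_contra hw
      rw [hout w hw] at h
      exact hw h
    · intro hw
      by_contra h
      have := π.injective (hout _ h)
      rw [this] at h
      exact h hw
  have := hS π ⟨p1, hmem, fun u _ v _ => p2 u v⟩
    (fun s hs _ => p4 s (hcon s hs).1 (hcon s hs).2) y (hyD (mem_below_self y))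
  exact hne (this.symm.trans p3)

/-- The only vertex of the tree whose parent is not in it is `x`, and `x` is fixed because no other
vertex of the tree lies in its cell. -/
lemma isFixingOn_below_iff [Finite W] (x : W) (S : Finset W) :
    IsFixingOn J κ (below κ R par x) S ↔ HitsSiblings κ R par (below κ R par x) S := by
  have hD : ∀ w ∈ below κ R par x, below κ R par w ⊆ below κ R par x := fun w hw => below_subset hw
  refine ⟨hJ.hitsSiblings_of_isFixingOn hD, fun h => hJ.isFixingOn_of_hitsSiblings hD h ?_⟩
  intro ρ hρ _ w hw hw'
  obtain rfl : w = x := by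
    rcases mem_below_iff.1 hw with h | h
    · exact h
    · exact (hw' h.1 h.2).elim
  exact hJ.eq_of_mem_below ((hρ.mem_iff w).2 hw) (by rw [hρ.cell])

lemma cellFixingNumber_below [Finite W] (x : W) :
    cellFixingNumber (J.induce (below κ R par x)) (fun v => κ v.1) =
      minCard (HitsSiblings κ R par (below κ R par x)) := by
  rw [cellFixingNumber_induce_eq_minCard]
  congr 1
  exact funext fun S => propext (hJ.isFixingOn_below_iff x S)

end IsJellyfish

/-- Only the part of a set below `x` matters. -/
lemma HitsSiblings.filter [DecidablePred (· ∈ D)] (hD : ∀ w ∈ D, below κ R par w ⊆ D)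
    {S : Finset W} (h : HitsSiblings κ R par D S) :
    HitsSiblings κ R par D (S.filter (· ∈ D)) := by
  intro y y' hne hκ hy hpar hpD
  obtain ⟨s, hs, hs'⟩ := h y y' hne hκ hy hpar hpD
  refine ⟨s, Finset.mem_filter.2 ⟨hs, ?_⟩, hs'⟩
  rcases hs' with h | h
  · exact hD _ (hD _ hpD (mem_below_of_par_mem hy (mem_below_self _))) h
  · exact hD _ (hD _ hpD (mem_below_of_par_mem (hκ ▸ hy) (hpar ▸ mem_below_self _))) h

lemma HitsSiblings.mono {E : Set W} (hE : E ⊆ D) {S T : Finset W} (hST : S ⊆ T)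
    (h : HitsSiblings κ R par D S) : HitsSiblings κ R par E T := by
  intro y y' hne hκ hy hpar hpE
  obtain ⟨s, hs, hs'⟩ := h y y' hne hκ hy hpar (hE hpE)
  exact ⟨s, hST hs, hs'⟩

lemma hitsSiblings_univ [Fintype W] : HitsSiblings κ R par D Finset.univ :=
  fun y _ _ _ _ _ _ => ⟨y, Finset.mem_univ y, Or.inl (mem_below_self y)⟩

end FixingOn

/-! ### Counting: the recursion and the whole jellyfish -/

section HitNumber

variable {W C : Type*}

/-- The least size of a set that meets enough trees below `x`. -/
noncomputable def hitNumber (κ : W → C) (R : C) (par : W → W) (x : W) : ℕ :=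
  minCard (HitsSiblings κ R par (below κ R par x))

variable {J : SimpleGraph W} {κ : W → C} {R : C} {par : W → W} {d : C → ℕ}

lemma exists_child_of_mem_below {x z : W} (h : z ∈ below κ R par x) :
    z = x ∨ ∃ c, κ c ≠ R ∧ par c = x ∧ z ∈ below κ R par c := by
  rcases Relation.ReflTransGen.cases_head h with h | ⟨c, hc, hcz⟩
  · exact Or.inl h.symm
  · exact Or.inr ⟨c, hc.1, hc.2, hcz⟩

/-- A set without elements below `x` could be replaced by the empty set. -/
lemma exists_mem_below_of_hitNumber_ne_zero {x : W} (h : hitNumber κ R par x ≠ 0) {S : Finset W}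
    (hS : HitsSiblings κ R par (below κ R par x) S) : ∃ s ∈ S, s ∈ below κ R par x := by
  classical
  by_contra! hcon
  have := hS.filter fun w hw => below_subset hw
  rw [Finset.filter_eq_empty_iff.2 hcon] at this
  exact h (Nat.le_zero.1 (minCard_le this))

lemma hitsSiblings_empty_of_hitNumber_eq_zero [Fintype W] {x : W} (h : hitNumber κ R par x = 0) :
    HitsSiblings κ R par (below κ R par x) ∅ := by
  obtain ⟨S, hS, hcard⟩ := exists_card_eq_minCard
    (P := HitsSiblings κ R par (below κ R par x)) ⟨_, hitsSiblings_univ⟩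
  have h0 : S.card = 0 := hcard.trans h
  rwa [Finset.card_eq_zero.1 h0] at hS

lemma hitNumber_le_card_filter {x : W} [DecidablePred (· ∈ below κ R par x)]
    {S : Finset W} (hS : HitsSiblings κ R par (below κ R par x) S) :
    hitNumber κ R par x ≤ (S.filter (· ∈ below κ R par x)).card :=
  minCard_le (hS.filter fun _ hw => below_subset hw)

namespace IsJellyfish

variable (hJ : IsJellyfish J κ R par d)
include hJ

/-- Unlike `eq_of_mem_below_of_mem_below`, this covers siblings in different cells, so the
contributions of all children of `x` can be added. -/
lemma eq_of_mem_below_of_par_eq {y y' z : W} (hy : κ y ≠ R) (hy' : κ y' ≠ R)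
    (hpar : par y = par y') (hz : z ∈ below κ R par y) (hz' : z ∈ below κ R par y') : y = y' := by
  induction z using hJ.depth_induction with
  | h z ih =>
    rcases mem_below_iff.1 hz with rfl | ⟨h1, h2⟩
    · rcases mem_below_iff.1 hz' with h | ⟨_, k2⟩
      · exact h
      · have := hJ.depth_le k2
        have := hJ.depth_lt y' hy'
        rw [hpar] at *
        omega
    · rcases mem_below_iff.1 hz' with rfl | ⟨_, k2⟩
      · have := hJ.depth_le h2
        have := hJ.depth_lt y hy
        rw [← hpar] at *
        omega
      · exact ih h1 h2 k2

/-- The recursion for the number of vertices needed below `x`. -/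
lemma hitNumber_eq [Fintype W] [DecidableEq C] [DecidableEq W] (x : W) (f : C → ℕ)
    (hf : ∀ y, κ y ≠ R → par y = x → hitNumber κ R par y = f (κ y)) :
    hitNumber κ R par x = ∑ Y ∈ (Finset.univ.filter fun y => κ y ≠ R ∧ par y = x).image κ,
      if f Y = 0 then {y | κ y = Y ∧ par y = x}.ncard - 1
      else {y | κ y = Y ∧ par y = x}.ncard * f Y := by
  classical
  set ch : Finset W := Finset.univ.filter fun y => κ y ≠ R ∧ par y = x with hch
  have hmem : ∀ y, y ∈ ch ↔ κ y ≠ R ∧ par y = x := fun y => by simp [hch]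
  have hfib : ∀ Y ∈ ch.image κ, {y | κ y = Y ∧ par y = x}.ncard = (ch.filter (κ · = Y)).card := by
    intro Y hY
    obtain ⟨y, hy, rfl⟩ := Finset.mem_image.1 hY
    rw [← Set.ncard_coe_finset]
    congr 1
    ext z
    simp only [Set.mem_ofPred_eq, Finset.coe_filter, hmem]
    constructor
    · rintro ⟨h1, h2⟩
      exact ⟨⟨h1 ▸ ((hmem y).1 hy).1, h2⟩, h1⟩
    · rintro ⟨⟨_, h2⟩, h1⟩
      exact ⟨h1, h2⟩
  rw [Finset.sum_congr rfl fun Y hY => by rw [hfib Y hY]]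
  have hfiber : ∀ t : W → ℕ, ∑ y ∈ ch, t y =
      ∑ Y ∈ ch.image κ, ∑ y ∈ ch.filter (κ · = Y), t y := fun t =>
    (Finset.sum_fiberwise_of_maps_to (fun y hy => Finset.mem_image_of_mem κ hy) t).symm
  have hchx : ∀ y ∈ ch, y ∈ below κ R par x := fun y hy =>
    mem_below_of_par_mem ((hmem y).1 hy).1 (by rw [((hmem y).1 hy).2]; exact mem_below_self x)
  refine le_antisymm ?_ ?_
  · have hT : ∀ y, ∃ T, HitsSiblings κ R par (below κ R par y) T ∧ T.card = hitNumber κ R par y :=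
      fun y => exists_card_eq_minCard ⟨_, hitsSiblings_univ⟩
    choose T hT hTcard using hT
    have hy₀ : ∀ Y, ∃ y₀, Y ∈ ch.image κ → y₀ ∈ ch.filter (κ · = Y) := by
      intro Y
      by_cases hY : Y ∈ ch.image κ
      · obtain ⟨y, hy, rfl⟩ := Finset.mem_image.1 hY
        exact ⟨y, fun _ => by simpa using hy⟩
      · exact ⟨x, fun h => (hY h).elim⟩
    choose y₀ hy₀ using hy₀
    -- An optimal set for each non-rigid tree, and the root of each rigid tree except for one
    -- exempted child `y₀ Y` per cell.
    set U : W → Finset W := fun y =>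
      if f (κ y) = 0 then (if y = y₀ (κ y) then ∅ else {y}) else T y with hU
    have hhits : HitsSiblings κ R par (below κ R par x) (ch.biUnion U) := by
      intro y y' hne hκ hy hpar hpx
      rcases exists_child_of_mem_below hpx with h | ⟨c, hc, hcx, hpc⟩
      · have hych : y ∈ ch := (hmem y).2 ⟨hy, h⟩
        have hych' : y' ∈ ch := (hmem y').2 ⟨hκ ▸ hy, hpar ▸ h⟩
        by_cases h0 : f (κ y) = 0
        · by_cases hyy : y = y₀ (κ y)
          · refine ⟨y', Finset.mem_biUnion.2 ⟨y', hych', ?_⟩, Or.inr (mem_below_self _)⟩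
            simp only [hU]
            rw [if_pos (hκ ▸ h0), if_neg]
            · exact Finset.mem_singleton_self _
            · rw [← hκ, ← hyy]
              exact hne.symm
          · refine ⟨y, Finset.mem_biUnion.2 ⟨y, hych, ?_⟩, Or.inl (mem_below_self _)⟩
            simp only [hU]
            rw [if_pos h0, if_neg hyy]
            exact Finset.mem_singleton_self _
        · obtain ⟨s, hs, hs'⟩ := exists_mem_below_of_hitNumber_ne_zero
            (by rw [hf y hy h]; exact h0) (hT y)
          refine ⟨s, Finset.mem_biUnion.2 ⟨y, hych, ?_⟩, Or.inl hs'⟩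
          simp only [hU]
          rwa [if_neg h0]
      · have hcch : c ∈ ch := (hmem c).2 ⟨hc, hcx⟩
        by_cases h0 : f (κ c) = 0
        · obtain ⟨s, hs, _⟩ := hitsSiblings_empty_of_hitNumber_eq_zero
            ((hf c hc hcx).trans h0) y y' hne hκ hy hpar hpc
          exact (Finset.notMem_empty s hs).elim
        · obtain ⟨s, hs, hs'⟩ := hT c y y' hne hκ hy hpar hpc
          refine ⟨s, Finset.mem_biUnion.2 ⟨c, hcch, ?_⟩, hs'⟩
          simp only [hU]
          rwa [if_neg h0]
    refine (minCard_le hhits).trans (Finset.card_biUnion_le.trans ?_)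
    rw [hfiber]
    refine Finset.sum_le_sum fun Y hY => ?_
    split_ifs with h0
    · rw [← Finset.card_erase_of_mem (hy₀ Y hY), Finset.card_eq_sum_ones,
        ← Finset.add_sum_erase _ _ (hy₀ Y hY)]
      have hY₀ := (Finset.mem_filter.1 (hy₀ Y hY)).2
      have e0 : U (y₀ Y) = ∅ := by
        simp only [hU]
        rw [hY₀, if_pos h0, if_pos rfl]
      rw [e0, Finset.card_empty, zero_add]
      refine Finset.sum_le_sum fun y hy => ?_
      have hyY := (Finset.mem_filter.1 (Finset.mem_of_mem_erase hy)).2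
      simp only [hU]
      rw [hyY, if_pos h0]
      split_ifs
      · exact zero_le_one
      · exact (Finset.card_singleton y).le
    · refine (Finset.sum_le_card_nsmul _ _ (f Y) fun y hy => ?_).trans (by simp)
      obtain ⟨hy1, rfl⟩ := Finset.mem_filter.1 hy
      simp only [hU, if_neg h0]
      rw [hTcard, hf y ((hmem y).1 hy1).1 ((hmem y).1 hy1).2]
  · obtain ⟨S, hS, hcard⟩ := exists_card_eq_minCard
      (P := HitsSiblings κ R par (below κ R par x)) ⟨_, hitsSiblings_univ⟩
    rw [hitNumber, ← hcard]
    calc _ ≤ ∑ Y ∈ ch.image κ, ∑ y ∈ ch.filter (κ · = Y), (S.filter (· ∈ below κ R par y)).card := ?_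
      _ = ∑ y ∈ ch, (S.filter (· ∈ below κ R par y)).card := (hfiber _).symm
      _ = (ch.biUnion fun y => S.filter (· ∈ below κ R par y)).card := ?_
      _ ≤ S.card := Finset.card_le_card (Finset.biUnion_subset.2 fun y _ => Finset.filter_subset _ _)
    · refine Finset.sum_le_sum fun Y hY => ?_
      split_ifs with h0
      -- At most one child in a cell has a tree that `S` misses; each of the others costs at least
      -- one vertex.
      · set Z := (ch.filter (κ · = Y)).filter
          fun y => (S.filter (· ∈ below κ R par y)).card = 0 with hZ
        have hZ1 : Z.card ≤ 1 := by
          rw [Finset.card_le_one]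
          intro y hy y' hy'
          simp only [hZ, Finset.mem_filter, Finset.card_eq_zero, Finset.filter_eq_empty_iff, hmem]
            at hy hy'
          by_contra hne
          obtain ⟨s, hs, hs'⟩ := hS y y' hne (hy.1.2.trans hy'.1.2.symm) hy.1.1.1
            (hy.1.1.2.trans hy'.1.1.2.symm) (by rw [hy.1.1.2]; exact mem_below_self x)
          exact hs'.elim (hy.2 hs) (hy'.2 hs)
        have hsplit := Finset.card_filter_add_card_filter_not (s := ch.filter (κ · = Y))
          (fun y => (S.filter (· ∈ below κ R par y)).card = 0)
        have hle : ((ch.filter (κ · = Y)).filter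
            fun y => ¬ (S.filter (· ∈ below κ R par y)).card = 0).card ≤
            ∑ y ∈ ch.filter (κ · = Y), (S.filter (· ∈ below κ R par y)).card := by
          rw [Finset.card_filter]
          refine Finset.sum_le_sum fun y _ => ?_
          split_ifs <;> omega
        rw [← hZ] at hsplit
        omega
      · refine le_trans (by simp) (Finset.card_nsmul_le_sum _ _ (f Y) fun y hy => ?_)
        obtain ⟨hy1, rfl⟩ := Finset.mem_filter.1 hy
        rw [← hf y ((hmem y).1 hy1).1 ((hmem y).1 hy1).2]
        exact hitNumber_le_card_filter (hS.mono (below_subset (hchx y hy1)) subset_rfl)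
    · refine (Finset.card_biUnion fun y hy y' hy' hne => ?_).symm
      rw [Function.onFun, Finset.disjoint_left]
      intro s hs hs'
      exact hne (hJ.eq_of_mem_below_of_par_eq ((hmem y).1 hy).1 ((hmem y').1 hy').1
        (((hmem y).1 hy).2.trans ((hmem y').1 hy').2.symm) (Finset.mem_filter.1 hs).2
        (Finset.mem_filter.1 hs').2)

/-- The number of vertices needed below `x` depends only on the cell of `x`. -/
lemma hitNumber_congr [Finite W] {x x' : W} (h : κ x = κ x') :
    hitNumber κ R par x = hitNumber κ R par x' := by
  classical
  have := Fintype.ofFinite W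
  -- Induction from the deepest cells upwards. By the induction hypothesis the values at the
  -- children are a function `f` of the cell alone; its value 0 at empty cells is never used.
  set N := Finset.univ.sup fun w => d (κ w) with hN
  have hle : ∀ w, d (κ w) ≤ N := fun w => Finset.le_sup (f := fun w => d (κ w)) (Finset.mem_univ w)
  induction hn : N - d (κ x) using Nat.strong_induction_on generalizing x x' with
  | _ n ih =>
    subst hn
    set f : C → ℕ := fun Y => if h : ∃ y, κ y = Y then hitNumber κ R par h.choose else 0 with hf
    have hchild : ∀ z, κ z = κ x → ∀ y, κ y ≠ R → par y = z → hitNumber κ R par y = f (κ y) := by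
      intro z hz y hy hyz
      have hex : ∃ y', κ y' = κ y := ⟨y, rfl⟩
      simp only [hf, dif_pos hex]
      have := hJ.depth_lt y hy
      rw [hyz, hz] at this
      have := hle y
      exact ih (N - d (κ y)) (by omega) hex.choose_spec.symm rfl
    rw [hJ.hitNumber_eq x f (hchild x rfl), hJ.hitNumber_eq x' f (hchild x' h.symm)]
    have himage : ∀ z z', κ z = κ z' →
        (Finset.univ.filter fun y => κ y ≠ R ∧ par y = z).image κ ⊆
        (Finset.univ.filter fun y => κ y ≠ R ∧ par y = z').image κ := by
      intro z z' hz Y hY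
      obtain ⟨y, hy, rfl⟩ := Finset.mem_image.1 hY
      simp only [Finset.mem_filter, Finset.mem_univ, true_and] at hy
      have h1 := hJ.ncard_children (κ y) hy.1 z z' hz
      have h2 : 0 < {y' | κ y' = κ y ∧ par y' = z}.ncard :=
        (Set.ncard_pos (Set.toFinite _)).2 ⟨y, rfl, hy.2⟩
      rw [h1, Set.ncard_pos (Set.toFinite _)] at h2
      obtain ⟨y', h3, h4⟩ := h2
      rw [← h3]
      refine Finset.mem_image_of_mem κ ?_
      simp only [Finset.mem_filter, Finset.mem_univ, true_and]
      exact ⟨by rw [h3]; exact hy.1, h4⟩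
    rw [(himage x x' h).antisymm (himage x' x h.symm)]
    refine Finset.sum_congr rfl fun Y hY => ?_
    obtain ⟨y, hy, rfl⟩ := Finset.mem_image.1 hY
    simp only [Finset.mem_filter, Finset.mem_univ, true_and] at hy
    rw [hJ.ncard_children (κ y) hy.1 x x' h]

/-- The fixing number of a jellyfish whose legs are not rigid. -/
lemma minCard_isFixingOn_univ_of_ne_zero [Finite W] {v : W} (hv : κ v = R)
    (h0 : hitNumber κ R par v ≠ 0) : minCard (IsFixingOn J κ Set.univ) =
      {w | κ w = R}.ncard * hitNumber κ R par v := by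
  classical
  have := Fintype.ofFinite W
  have huniv : ∀ w ∈ (Set.univ : Set W), below κ R par w ⊆ Set.univ := fun _ _ => Set.subset_univ _
  set H : Finset W := Finset.univ.filter fun w => κ w = R with hH
  have hcongr : ∀ w ∈ H, hitNumber κ R par w = hitNumber κ R par v := fun w hw =>
    hJ.hitNumber_congr ((Finset.mem_filter.1 hw).2.trans hv.symm)
  rw [Set.ncard_eq_toFinset_card', Set.toFinset_ofPred, ← hH]
  refine le_antisymm ?_ ?_
  · have hT : ∀ y, ∃ T, HitsSiblings κ R par (below κ R par y) T ∧ T.card = hitNumber κ R par y :=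
      fun y => exists_card_eq_minCard ⟨_, hitsSiblings_univ⟩
    choose T hT hTcard using hT
    refine (minCard_le (S := H.biUnion T) ?_).trans (Finset.card_biUnion_le.trans ?_)
    · refine hJ.isFixingOn_of_hitsSiblings huniv ?_ ?_
      · intro y y' hne hκ hy hpar _
        obtain ⟨w, hw, hwy⟩ := hJ.exists_root (par y)
        obtain ⟨s, hs, hs'⟩ := hT w y y' hne hκ hy hpar hwy
        exact ⟨s, Finset.mem_biUnion.2 ⟨w, by simp [hH, hw], hs⟩, hs'⟩
      · intro ρ hρ hfix w _ hw
        have hwR : κ w = R := by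
          by_contra h
          exact hw h trivial
        have hwH : w ∈ H := by simp [hH, hwR]
        -- A non-rigid leg contains a fixed vertex, and legs are disjoint, so the head vertex at its
        -- top is fixed as well.
        obtain ⟨s, hs, hs'⟩ := exists_mem_below_of_hitNumber_ne_zero
          (by rw [hcongr w hwH]; exact h0) (hT w)
        have h1 := hJ.apply_mem_below huniv hρ trivial hs'
        rw [hfix s (Finset.mem_biUnion.2 ⟨w, hwH, hs⟩) trivial] at h1
        exact hJ.eq_of_mem_below_of_mem_below (hρ.cell w) h1 hs'
    · refine (Finset.sum_le_card_nsmul _ _ (hitNumber κ R par v) fun w hw => ?_).trans (by simp)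
      rw [hTcard, hcongr w hw]
  · obtain ⟨S, hS, hcard⟩ := exists_card_eq_minCard (P := IsFixingOn J κ Set.univ)
      ⟨_, isFixingOn_univ⟩
    have hhit := hJ.hitsSiblings_of_isFixingOn huniv hS
    rw [← hcard]
    calc _ ≤ ∑ w ∈ H, (S.filter (· ∈ below κ R par w)).card := by
          refine le_trans (by simp) (Finset.card_nsmul_le_sum _ _ (hitNumber κ R par v)
            fun w hw => ?_)
          rw [← hcongr w hw]
          exact hitNumber_le_card_filter (hhit.mono (Set.subset_univ _) subset_rfl)
      _ = (H.biUnion fun w => S.filter (· ∈ below κ R par w)).card := by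
          refine (Finset.card_biUnion fun y hy y' hy' hne => ?_).symm
          rw [Function.onFun, Finset.disjoint_left]
          intro s hs hs'
          exact hne (hJ.eq_of_mem_below_of_mem_below
            ((Finset.mem_filter.1 hy).2.trans (Finset.mem_filter.1 hy').2.symm)
            (Finset.mem_filter.1 hs).2 (Finset.mem_filter.1 hs').2)
      _ ≤ S.card :=
          Finset.card_le_card (Finset.biUnion_subset.2 fun y _ => Finset.filter_subset _ _)

/-- The fixing number of a jellyfish whose legs are rigid. -/
lemma minCard_isFixingOn_univ_of_eq_zero [Finite W] {v : W} (hv : κ v = R)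
    (h0 : hitNumber κ R par v = 0) : minCard (IsFixingOn J κ Set.univ) =
      fixingNumber (J.induce {w | κ w = R}) := by
  classical
  have := Fintype.ofFinite W
  have huniv : ∀ w ∈ (Set.univ : Set W), below κ R par w ⊆ Set.univ := fun _ _ => Set.subset_univ _
  refine le_antisymm (minCard_le_minCard (Q := IsFixingSet (J.induce {w | κ w = R}))
    ⟨Finset.univ, fun _ h w => h w (Finset.mem_univ w)⟩ fun S hS => ?_)
    (minCard_le_minCard (P := IsFixingSet (J.induce {w | κ w = R})) ⟨_, isFixingOn_univ⟩
      fun S hS => ?_)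
  · refine ⟨S.map (Function.Embedding.subtype _), hJ.isFixingOn_of_hitsSiblings huniv ?_ ?_,
      (Finset.card_map _).le⟩
    · intro y y' hne hκ hy hpar _
      obtain ⟨w, hw, hwy⟩ := hJ.exists_root (par y)
      obtain ⟨s, hs, _⟩ := hitsSiblings_empty_of_hitNumber_eq_zero
        ((hJ.hitNumber_congr (hw.trans hv.symm)).trans h0) y y' hne hκ hy hpar hwy
      exact (Finset.notMem_empty s hs).elim
    · intro ρ hρ hfix w _ hw
      have hwR : κ w = R := by
        by_contra h
        exact hw h trivial
      have := hS ⟨ρ.subtypePerm fun w => by simp only [Set.mem_ofPred_eq, hρ.cell],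
        fun {a b} => hρ.adj_iff a trivial b trivial⟩
        (fun s hs => Subtype.ext (hfix s (Finset.mem_map_of_mem _ hs) trivial)) ⟨w, hwR⟩
      exact congrArg Subtype.val this
  -- Each element of `S` is replaced by the head vertex above it. An automorphism of the head fixing
  -- these extends to `J` and fixes the legs at them pointwise, hence `S`.
  · choose t ht hts using hJ.exists_root
    refine ⟨S.image fun s => ⟨t s, ht s⟩, fun σ hσ w => ?_, Finset.card_image_le⟩
    have hcell : ∀ w, κ (Equiv.Perm.ofSubtype σ.toEquiv w) = κ w := by
      intro w
      by_cases hw : κ w = R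
      · rw [Equiv.Perm.ofSubtype_apply_of_mem _ (show w ∈ {w | κ w = R} from hw)]
        exact (σ ⟨w, hw⟩).2.trans hw.symm
      · rw [Equiv.Perm.ofSubtype_apply_of_not_mem _ (show w ∉ {w | κ w = R} from hw)]
    obtain ⟨π, p1, p2, p3, p4⟩ := hJ.exists_extension R (Equiv.Perm.ofSubtype σ.toEquiv) hcell
      (fun w h1 h2 => (h2 h1).elim)
    have hval : ∀ w : {w | κ w = R}, π w = (σ w : W) := by
      intro w
      rw [p2 w w.2]
      exact Equiv.Perm.ofSubtype_apply_coe _ w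
    have hadj := hJ.adj_iff_of_par p1 p3 fun u v hu hv => by
      rw [hval ⟨u, hu⟩, hval ⟨v, hv⟩]
      exact σ.map_rel_iff (a := ⟨u, hu⟩) (b := ⟨v, hv⟩)
    have := hS π ⟨p1, fun _ => by simp, fun u _ v _ => hadj u v⟩ (fun s hs _ => p4 s fun z hz hsz => by
      obtain rfl : z = t s := hJ.eq_of_mem_below_of_mem_below (hz.trans (ht s).symm) hsz (hts s)
      have := hσ ⟨t s, ht s⟩ (Finset.mem_image_of_mem _ hs)
      rw [Equiv.Perm.ofSubtype_apply_of_mem _ (show t s ∈ {w | κ w = R} from ht s)]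
      exact congrArg Subtype.val this) w trivial
    rw [hval] at this
    exact Subtype.ext this

end IsJellyfish

end HitNumber

/-! ### The modified graph of an amenable graph -/

section Main

variable {V : Type u} {G : SimpleGraph V} {A : AnisotropicComponent G} {R : Cell G}

lemma not_jellyfish_adj_of_cellOf_eq {u v : compVerts A} (huv : cellOf G u.1 = cellOf G v.1)
    (hR : cellOf G u.1 ≠ R) (hhom : IsHomogeneous G (cellOf G u.1)) :
    ¬ (jellyfish A R).Adj u v := by
  have hne : ∀ {x y : compVerts A}, x ≠ y → x.1 ≠ y.1 := fun h k => h (Subtype.ext k)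
  rintro ⟨huv', ⟨h1, h2⟩ | ⟨h1, h2⟩⟩
  · rcases hhom with h | h
    · exact h u rfl v huv.symm h1
    · exact h2 (Or.inr (Or.inl ⟨huv, hR, h⟩))
  · rcases h2 with ⟨-, h, -⟩ | ⟨-, -, h⟩ | ⟨h, -⟩ | ⟨h, -⟩
    · exact hR h
    · exact h1 (h u rfl v huv.symm (hne huv'))
    · exact h huv
    · exact h huv

lemma not_jellyfish_adj_of_isIsotropic {u v : compVerts A} (huv : cellOf G u.1 ≠ cellOf G v.1)
    (hiso : IsIsotropic G (cellOf G u.1) (cellOf G v.1)) : ¬ (jellyfish A R).Adj u v := by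
  rintro ⟨-, ⟨h1, h2⟩ | ⟨h1, h2⟩⟩
  · rcases id hiso with h | h
    · exact h u rfl v rfl h1
    · exact h2 (Or.inr (Or.inr (Or.inl ⟨huv, hiso, h⟩)))
  · rcases h2 with ⟨h, -⟩ | ⟨h, -⟩ | ⟨-, -, h⟩ | ⟨-, h, -⟩
    · exact huv h
    · exact huv h
    · exact h1 (h u rfl v rfl)
    · exact h hiso

/-- In `J`, an anisotropic pair of cells induces a disjoint union of stars, with the centers in the
smaller cell. -/
lemma IsAmenable.exists_isStarsFrom_jellyfish [Finite V] (hG : IsAmenable G) {X Y : Cell G}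
    (hadj : (anisotropicGraph G).Adj X Y) (hle : X.size ≤ Y.size) :
    ∃ rel : V → V → Prop, IsStarsFrom rel X.verts Y.verts ∧
      ∀ u v : compVerts A, cellOf G u.1 = X → cellOf G v.1 = Y →
        ((jellyfish A R).Adj u v ↔ rel u v) := by
  have hC : IsComplemented R X Y ↔ IsCoStarsBetween G X.verts Y.verts := by
    constructor
    · rintro (⟨h, -⟩ | ⟨h, -⟩ | ⟨-, h, -⟩ | ⟨-, -, h⟩)
      · exact (hadj.1 h).elim
      · exact (hadj.1 h).elim
      · exact (hadj.2 h).elim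
      · exact h
    · exact fun h => Or.inr (Or.inr (Or.inr ⟨hadj.1, hadj.2, h⟩))
  have hJ : ∀ u v : compVerts A, cellOf G u.1 = X → cellOf G v.1 = Y →
      ((jellyfish A R).Adj u v ↔ (G.Adj u v ∧ ¬ IsCoStarsBetween G X.verts Y.verts) ∨
        (¬ G.Adj u v ∧ IsCoStarsBetween G X.verts Y.verts)) := by
    intro u v hu hv
    have hne : u ≠ v := by
      rintro rfl
      exact hadj.1 (hu.symm.trans hv)
    rw [← hC]
    simp only [jellyfish, hu, hv, hne, ne_eq, not_false_eq_true, true_and]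
  by_cases hco : IsCoStarsBetween G X.verts Y.verts
  · refine ⟨fun a b => ¬ G.Adj a b, ?_, fun u v hu hv => by simp [hJ u v hu hv, hco]⟩
    rcases hco with h | h
    · exact h
    -- Centers in the cell that is not smaller mean a matching, which can be read from either side.
    · exact h.flip (fun u v => not_congr (G.adj_comm u v)) Y.verts_nonempty hle
  · refine ⟨G.Adj, ?_, fun u v hu hv => by simp [hJ u v hu hv, hco]⟩
    rcases hG.isStarsFrom hadj.1 hadj.2 hle with h | h
    · exact h
    · exact (hco (Or.inl h)).elim

/-- A cell of `A` lies entirely in `compVerts A`, so counting inside the component loses nothing. -/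
lemma ncard_subtype_compVerts {X : Cell G} (hX : X ∈ A.supp) (P : V → Prop) :
    {w : compVerts A | cellOf G w.1 = X ∧ P w}.ncard = {w | w ∈ X.verts ∧ P w}.ncard := by
  rw [← Set.ncard_image_of_injective _ Subtype.val_injective]
  congr 1
  ext w
  constructor
  · rintro ⟨z, hz, rfl⟩
    exact hz
  · rintro ⟨h1, h2⟩
    exact ⟨⟨w, show cellOf G w ∈ A.supp from (show cellOf G w = X from h1) ▸ hX⟩, ⟨h1, h2⟩, rfl⟩

/-- The graph `J` of an amenable graph consists of its head and of rooted trees attached to it. -/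
theorem IsAmenable.exists_isJellyfish [Finite V] (hG : IsAmenable G) (hR : IsRoot A R) :
    ∃ (par : compVerts A → compVerts A) (d : Cell G → ℕ),
      IsJellyfish (jellyfish A R) (fun w => cellOf G w.1) R par d ∧
      (∀ x y, IsParent A R x y ↔ cellOf G y.1 ≠ R ∧ par y = x) ∧
      (∀ y, cellOf G y.1 ≠ R → IsChildCell R (cellOf G (par y).1) (cellOf G y.1)) ∧
      ∀ X ∈ A.supp, ∀ Y, IsChildCell R X Y → Y ≠ R ∧ ∃ t, 1 ≤ t ∧ Y.size = X.size * t ∧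
        ∀ x : compVerts A, cellOf G x.1 = X → {y | cellOf G y.1 = Y ∧ par y = x}.ncard = t := by
  obtain ⟨p, hp, htree⟩ := hG.exists_parentCell hR
  have hpA : ∀ Y ∈ A.supp, Y ≠ R → p Y ∈ A.supp := fun Y hY hYR =>
    mem_supp_of_adj (hp Y hY hYR).1.1 hY
  -- Sizes do not decrease away from the root, so the centers of the stars lie in the parent cell
  -- and every leaf has exactly one parent. Head vertices get a default parent below.
  have hstar : ∀ Y ∈ A.supp, Y ≠ R → ∃ rel : V → V → Prop, IsStarsFrom rel (p Y).verts Y.verts ∧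
      ∀ u v : compVerts A, cellOf G u.1 = p Y → cellOf G v.1 = Y →
        ((jellyfish A R).Adj u v ↔ rel u v) := fun Y hY hYR =>
    hG.exists_isStarsFrom_jellyfish (hp Y hY hYR).1.1 (hp Y hY hYR).2.1
  have hpar : ∀ w : compVerts A, ∃ x : compVerts A, cellOf G w.1 ≠ R →
      cellOf G x.1 = p (cellOf G w.1) ∧
        ∀ x' : compVerts A, cellOf G x'.1 = p (cellOf G w.1) →
          ((jellyfish A R).Adj x' w ↔ x = x') := by
    intro w
    by_cases hw : cellOf G w.1 = R
    · exact ⟨w, fun h => (h hw).elim⟩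
    obtain ⟨rel, ⟨t, -, -, huniq⟩, hrel⟩ := hstar _ w.2 hw
    obtain ⟨x, ⟨hx, hxw⟩, hx'⟩ := huniq w rfl
    have hxA : x ∈ compVerts A :=
      show cellOf G x ∈ A.supp from (show cellOf G x = _ from hx) ▸ hpA _ w.2 hw
    refine ⟨⟨x, hxA⟩, fun _ => ⟨hx, fun x' hc => ?_⟩⟩
    rw [hrel x' w hc rfl]
    constructor
    · exact fun h => Subtype.ext (hx' x' ⟨hc, h⟩).symm
    · rintro rfl
      exact hxw
  choose par hpar using hpar
  have hchild : ∀ X ∈ A.supp, ∀ Y, IsChildCell R X Y → Y ∈ A.supp ∧ Y ≠ R ∧ X = p Y := by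
    intro X hX Y hXY
    have hY : Y ∈ A.supp := mem_supp_of_adj hXY.1.symm hX
    have hYR : Y ≠ R := by
      rintro rfl
      have := hXY.2
      rw [SimpleGraph.dist_self] at this
      omega
    refine ⟨hY, hYR, ?_⟩
    rcases htree X hX Y hY hXY.1 with h | ⟨hXR, h⟩
    · exact h.2
    · have h1 := (hp X hX hXR).1.2
      have h2 := hXY.2
      rw [← h] at h1
      omega
  have hcount : ∀ Y ∈ A.supp, Y ≠ R → ∃ t, 1 ≤ t ∧ Y.size = (p Y).size * t ∧
      ∀ x : compVerts A, cellOf G x.1 = p Y → {y | cellOf G y.1 = Y ∧ par y = x}.ncard = t := by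
    intro Y hY hYR
    obtain ⟨rel, hs, hrel⟩ := hstar Y hY hYR
    obtain ⟨t, ht, hb⟩ := isStarsFrom_iff.1 hs
    refine ⟨t, ht, ?_, fun x hx => ?_⟩
    · have := hb.card_mul
      rw [Nat.card_coe_set_eq, Nat.card_coe_set_eq, mul_one] at this
      exact this.symm
    · rw [← hb.1 ⟨x, hx⟩, ncard_subtype_mem (rel x), ← ncard_subtype_compVerts hY]
      congr 1
      ext y
      refine and_congr_right fun hy => ?_
      have hyR : cellOf G y.1 ≠ R := by rwa [hy]
      rw [← (hpar y hyR).2 x (by rw [hy, hx]), hrel x y hx hy]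
  refine ⟨par, fun Y => (anisotropicGraph G).dist R Y, ⟨?_, ?_, ?_, ?_⟩, ?_, ?_, ?_⟩
  · intro w hw
    rw [(hpar w hw).1, (hp _ w.2 hw).1.2]
    exact Nat.lt_succ_self _
  · intro w w' hw hww'
    have hw' : cellOf G w'.1 ≠ R := fun h => hw (hww'.trans h)
    rw [(hpar w hw).1, (hpar w' hw').1, hww']
  · intro Y hYR x x' hxx'
    have hempty : ∀ x : compVerts A, ¬ (Y ∈ A.supp ∧ cellOf G x.1 = p Y) →
        {y : compVerts A | cellOf G y.1 = Y ∧ par y = x} = ∅ := by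
      intro x hx
      rw [Set.eq_empty_iff_forall_notMem]
      rintro y ⟨rfl, rfl⟩
      exact hx ⟨y.2, (hpar y hYR).1⟩
    by_cases h : Y ∈ A.supp ∧ cellOf G x.1 = p Y
    · obtain ⟨t, -, -, ht⟩ := hcount Y h.1 hYR
      rw [ht x h.2, ht x' (hxx'.symm.trans h.2)]
    · rw [hempty x h, hempty x' (fun h' => h ⟨h'.1, hxx'.trans h'.2⟩)]
  · intro u v huv
    constructor
    · intro h
      -- Outside the head, homogeneous cells and isotropic pairs carry no edges of `J`. The
      -- remaining edges lie on anisotropic pairs, which are the tree edges.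
      by_cases hcell : cellOf G u.1 = cellOf G v.1
      · have huR : cellOf G u.1 ≠ R := fun h => huv ⟨h, hcell.symm.trans h⟩
        exact (not_jellyfish_adj_of_cellOf_eq hcell huR (hp _ u.2 huR).2.2 h).elim
      · have haniso : (anisotropicGraph G).Adj (cellOf G u.1) (cellOf G v.1) :=
          ⟨hcell, fun hiso => not_jellyfish_adj_of_isIsotropic hcell hiso h⟩
        rcases htree _ u.2 _ v.2 haniso with ⟨h1, h2⟩ | ⟨h1, h2⟩
        · exact Or.inl ⟨h1, ((hpar v h1).2 u h2).1 h⟩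
        · exact Or.inr ⟨h1, ((hpar u h1).2 v h2).1 h.symm⟩
    · rintro (⟨h1, rfl⟩ | ⟨h1, rfl⟩)
      · exact ((hpar v h1).2 _ (hpar v h1).1).2 rfl
      · exact (((hpar u h1).2 _ (hpar u h1).1).2 rfl).symm
  · intro x y
    constructor
    · rintro ⟨h1, h2⟩
      obtain ⟨-, h3, h4⟩ := hchild _ x.2 _ h1
      exact ⟨h3, ((hpar y h3).2 x h4).1 h2⟩
    · rintro ⟨h1, rfl⟩
      refine ⟨?_, ((hpar y h1).2 _ (hpar y h1).1).2 rfl⟩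
      rw [(hpar y h1).1]
      exact (hp _ y.2 h1).1
  · intro y hy
    rw [(hpar y hy).1]
    exact (hp _ y.2 hy).1
  · intro X hX Y hXY
    obtain ⟨hY, hYR, rfl⟩ := hchild X hX Y hXY
    exact ⟨hYR, hcount Y hY hYR⟩

end Main

end AmenableGraph

/-! ### The theorem -/

open AmenableGraph
theorem mainTheorem8 {V : Type*} [Finite V] (G : SimpleGraph V) (hG : IsAmenable G)
    (A : AnisotropicComponent G) (R : Cell G) (hR : IsRoot A R) :
    -- the fixing number of the celled jellyfish, through any of its legs
    (∀ v ∈ headVerts A R,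
      (fixLeg A R v = 0 → fixJellyfish A R = fixingNumber (head A R)) ∧
      (fixLeg A R v ≠ 0 → fixJellyfish A R = (headVerts A R).ncard * fixLeg A R v)) ∧
    -- the recursion for the subtrees `L_x`, with `m_Y = |Y| / |X|` for the children `Y` of `X`
    (∀ X ∈ A.supp,
      (∀ Y, IsChildCell R X Y → X.size ∣ Y.size) ∧
      ∀ x : compVerts A, cellOf G x = X →
        ∀ y : Cell G → compVerts A, (∀ Y, IsChildCell R X Y → cellOf G (y Y) = Y) →
          fixLeg A R x = ∑ᶠ (Y : Cell G) (_ : IsChildCell R X Y),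
            if fixLeg A R (y Y) = 0 then Y.size / X.size - 1
            else (Y.size / X.size) * fixLeg A R (y Y)) := by
  classical
  have := Fintype.ofFinite (compVerts A)
  obtain ⟨par, d, hJ, hparent, hpcell, hchild⟩ := hG.exists_isJellyfish hR
  have hleg : ∀ x, legVerts A R x = below (fun w : compVerts A => cellOf G w.1) R par x := by
    intro x
    unfold legVerts below
    rw [show IsParent A R = fun x y => cellOf G y.1 ≠ R ∧ par y = x from
      funext₂ fun x y => propext (hparent x y)]
  have hfix : ∀ x, fixLeg A R x = hitNumber (fun w : compVerts A => cellOf G w.1) R par x := by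
    intro x
    -- The vertex set is made a variable because it occurs in the type of the induced graph.
    have key : ∀ D, D = below (fun w : compVerts A => cellOf G w.1) R par x →
        cellFixingNumber ((jellyfish A R).induce D) (fun v => cellOf G v.1.1) =
          hitNumber (fun w : compVerts A => cellOf G w.1) R par x := by
      rintro _ rfl
      exact hJ.cellFixingNumber_below x
    exact key _ (hleg x)
  have hjelly : fixJellyfish A R =
      minCard (IsFixingOn (jellyfish A R) (fun w => cellOf G w.1) Set.univ) :=
    cellFixingNumber_eq_minCard_univ _ _
  refine ⟨fun v hv => ⟨fun h => ?_, fun h => ?_⟩, fun X hX => ⟨fun Y hXY => ?_, ?_⟩⟩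
  · rw [hfix] at h
    rw [hjelly]
    exact hJ.minCard_isFixingOn_univ_of_eq_zero hv h
  · rw [hfix] at h ⊢
    rw [hjelly]
    exact hJ.minCard_isFixingOn_univ_of_ne_zero hv h
  · obtain ⟨-, t, -, ht, -⟩ := hchild X hX Y hXY
    exact Dvd.intro t ht.symm
  · intro x hx y hy
    have hXpos : 0 < X.size := (Set.ncard_pos (Set.toFinite _)).2 X.verts_nonempty
    -- Every child cell of `X` contains a child of `x`, as its stars have at least one leaf; so the
    -- `finsum` runs over the cells in the recursion for `x`.
    have hmem : ∀ Y, IsChildCell R X Y ↔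
        Y ∈ (Finset.univ.filter fun w : compVerts A => cellOf G w.1 ≠ R ∧ par w = x).image
          fun w => cellOf G w.1 := by
      intro Y
      simp only [Finset.mem_image, Finset.mem_filter, Finset.mem_univ, true_and]
      constructor
      · intro hXY
        obtain ⟨hYR, t, ht, -, hcount⟩ := hchild X hX Y hXY
        have hpos : 0 < {w : compVerts A | cellOf G w.1 = Y ∧ par w = x}.ncard := by
          rw [hcount x hx]
          exact ht
        obtain ⟨w, hw, hwx⟩ := (Set.ncard_pos (Set.toFinite _)).1 hpos
        exact ⟨w, ⟨by rwa [hw], hwx⟩, hw⟩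
      · rintro ⟨w, ⟨hw, rfl⟩, rfl⟩
        rw [← hx]
        exact hpcell w hw
    have hyfix : ∀ w : compVerts A, cellOf G w.1 ≠ R → par w = x →
        hitNumber (fun w : compVerts A => cellOf G w.1) R par w = fixLeg A R (y (cellOf G w.1)) := by
      intro w hw hwx
      rw [hfix]
      refine hJ.hitNumber_congr (hy _ ?_).symm
      rw [← hx, ← hwx]
      exact hpcell w hw
    rw [hfix, hJ.hitNumber_eq x (fun Y => fixLeg A R (y Y)) hyfix,
      finsum_cond_eq_sum_of_cond_iff _ fun _ => hmem _]
    refine Finset.sum_congr rfl fun Y hY => ?_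
    obtain ⟨-, t, -, ht, hcount⟩ := hchild X hX Y ((hmem Y).2 hY)
    have hm : {w : compVerts A | cellOf G w.1 = Y ∧ par w = x}.ncard = Y.size / X.size := by
      rw [hcount x hx, ht, Nat.mul_div_cancel_left _ hXpos]
    rw [← hm]
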